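/- **Setting.** Let $\mathbf U\in\mathbb C^{n_3\times n_3}$ be unitary. For $\mathcal X\in\mathbb R^{n_1\times n_2\times n_3}$ let $\widehat{\mathcal X}^{\langle k\rangle}\in\mathbb C^{n_1\times n_2}$, $\widehat{\mathcal X}^{\langle k\rangle}_{ij}=\sum_l \mathbf U_{kl}\mathcal X_{ijl}$, be the frontal slices of $\mathcal X$ transformed by $\mathbf U$, and for $s:\mathbb R\to\mathbb R$ put $S_s(\mathcal X)=\sum_{k=1}^{n_3}\sum_{j=1}^{\min\{n_1,n_2\}}s(\sigma_j(\widehat{\mathcal X}^{\langle k\rangle}))$, where $\sigma_j$ is the $j$-th largest singular value. Let $\lambda,\beta,c>0$ and $D=\{\mathcal X:\max|\mathcal X_{ijk}|\le c\}$, with indicator function $\delta_D$ ($0$ on $D$, $+\infty$ elsewhere). Let $g:\mathbb R\to[0,\infty)$ be even, with $g(0)=0$, concave and non-decreasing on $[0,\infty)$, with $g(x)/x$ non-increasing on $(0,\infty)$, differentiable on $\mathbb R\setminus\{0\}$, with $\lim_{x\to0^+}g'(x)=\lambda k_0$ and $g'\le\lambda k_0$ on $(0,\infty)$ for some $k_0>0$,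 and with $g(x)+\frac\mu2x^2$ convex on $(0,\infty)$ for some $\mu>0$. Let $g=s_1-s_2$ with $s_1,s_2:\mathbb R\to\mathbb R$ convex, $s_2$ even and differentiable with $s_2'$ locally Lipschitz. Let $f:\mathbb R^{n_1\times n_2\times n_3}\to\mathbb R$ be differentiable with $\nabla f$ Lipschitz with constant $L\ge 0$. Write $G=S_g$, $S_1=S_{s_1}$, $S_2=S_{s_2}$, $H=f+\beta G+\delta_D$, and $$Q(\mathcal X,\mathcal Y)=f(\mathcal Y)+\langle\nabla f(\mathcal Y),\mathcal X-\mathcal Y\rangle+\tfrac\rho2\|\mathcal X-\mathcal Y\|_F^2+\beta S_1(\mathcal X)-\beta S_2(\mathcal Y)-\beta\langle\nabla S_2(\mathcal Y),\mathcal X-\mathcal Y\rangle+\delta_D(\mathcal X).$$ Subdifferentials $\partial$ are limiting subdifferentials. A proper lower semicontinuous function $F$ has the KL property at $x^*$ with $\partial F(x^*)\ne\emptyset$ if there are a neighbourhood $V$ of $x^*$, $\eta\in(0,\infty]$ and a continuous concave $\varphi:[0,\eta)\to[0,\infty)$, $\varphi(0)=0$, that is $C^1$ with $\varphi'>0$ on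 $(0,\eta)$, such that $\varphi'(F(x)-F(x^*))\operatorname{dist}(0,\partial F(x))\ge1$ for all $x\in V$ with $F(x^*)<F(x)<F(x^*)+\eta$ (with $\operatorname{dist}(0,\emptyset)=+\infty$). It has exponent $\alpha\in[0,1)$ if one may take $\varphi(s)=\mu_1s^{1-\alpha}$ with $\mu_1>0$. A KL function is a proper lower semicontinuous function that has the KL property at every point where $\partial F\neq\emptyset$. **Theorem.** Suppose that $f$ and $g$ are KL functions, $0<\xi<\frac12$ and $\rho>\frac{L}{1-2\xi}$. Let $(\mathcal X^t)_{t\ge0}$ be generated by the inexact proximal majorization-minimization (PMM) algorithm, i.e. for every $t\ge0$ there is $\mathcal W^{t+1}\in\partial Q(\cdot,\mathcal X^t)(\mathcal X^{t+1})$ with $\|\mathcal W^{t+1}\|_F\le\xi\rho\|\mathcal X^{t+1}-\mathcal X^t\|_F$. Let $\tilde{\mathcal X}$ be an accumulation point of $(\mathcal X^t)$ (for instance its limit) at which $H$ has the KL property with exponent $\alpha\in[0,1)$. Then $\mathcal X^t\to\tilde{\mathcal X}$, and: (i) if $\alpha=0$, then $\mathcal X^t=\tilde{\mathcal X}$ for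 all sufficiently large $t$; (ii) if $0<\alpha\le\frac12$, there are $w>0$ and $\vartheta\in[0,1)$ with $\|\mathcal X^t-\tilde{\mathcal X}\|_F\le w\vartheta^t$ for all $t\ge0$; (iii) if $\frac12<\alpha<1$, there is $w>0$ with $\|\mathcal X^t-\tilde{\mathcal X}\|_F\le w\,t^{-\frac{1-\alpha}{2\alpha-1}}$ for all $t\ge1$. -/

import Mathlib

open Filter Topology Set

noncomputable section

namespace PMM

/-! ### Subdifferentials and the Kurdyka-Lojasiewicz property -/

section Subdifferential

variable {E : Type*} [NormedAddCommGroup E] [InnerProductSpace ℝ E]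

/-- The regular subdifferential of an extended-real-valued function at a point where it is
finite (it is empty at all other points). -/
def regularSubdifferential (f : E → EReal) (x : E) : Set E :=
  {y | f x ≠ ⊥ ∧ f x ≠ ⊤ ∧
    0 ≤ liminf (fun z => (f z - f x - ((inner ℝ y (z - x) : ℝ) : EReal)) /
      ((‖z - x‖ : ℝ) : EReal)) (𝓝[≠] x)}

/-- The limiting subdifferential of an extended-real-valued function at a point where it is
finite (it is empty at all other points). -/
def subdifferential (f : E → EReal) (x : E) : Set E :=
  {y | f x ≠ ⊥ ∧ f x ≠ ⊤ ∧ ∃ (u : ℕ → E) (v : ℕ → E),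
    Tendsto u atTop (𝓝 x) ∧ Tendsto (fun k => f (u k)) atTop (𝓝 (f x)) ∧
    Tendsto v atTop (𝓝 y) ∧ ∀ k, v k ∈ regularSubdifferential f (u k)}

/-- `φ` is a desingularizing function on `[0, η)`, where `η ∈ (0, +∞]`. -/
structure IsDesingularizing (φ : ℝ → ℝ) (η : EReal) : Prop where
  eta_pos : 0 < η
  continuousOn : ContinuousOn φ {s : ℝ | 0 ≤ s ∧ (s : EReal) < η}
  concaveOn : ConcaveOn ℝ {s : ℝ | 0 ≤ s ∧ (s : EReal) < η} φ
  nonneg : ∀ s : ℝ, 0 ≤ s → (s : EReal) < η → 0 ≤ φ s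
  map_zero : φ 0 = 0
  contDiffOn : ContDiffOn ℝ 1 φ {s : ℝ | 0 < s ∧ (s : EReal) < η}
  deriv_pos : ∀ s : ℝ, 0 < s → (s : EReal) < η → 0 < deriv φ s

/-- The proper lower semicontinuous function `f` has the KL property at `x₀ ∈ dom (∂f)` with the
desingularizing function `φ` on `[0, η)`, for some `η ∈ (0, +∞]` and some neighbourhood of `x₀`.
The distance from `0` to the empty set is `+∞`. -/
structure HasKLPropertyWith (f : E → EReal) (x₀ : E) (φ : ℝ → ℝ) : Prop where
  ne_bot : ∀ x, f x ≠ ⊥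
  exists_ne_top : ∃ x, f x ≠ ⊤
  lowerSemicontinuous : LowerSemicontinuous f
  mem_dom : (subdifferential f x₀).Nonempty
  ineq : ∃ η : EReal, IsDesingularizing φ η ∧ ∃ V ∈ 𝓝 x₀, ∀ x ∈ V,
    f x₀ < f x → f x < f x₀ + η →
      1 ≤ ENNReal.ofReal (deriv φ (f x - f x₀).toReal) * Metric.infEDist 0 (subdifferential f x)

/-- The KL property at a point. -/
def HasKLProperty (f : E → EReal) (x₀ : E) : Prop :=
  ∃ φ : ℝ → ℝ, HasKLPropertyWith f x₀ φ

/-- KL functions: proper lower semicontinuous functions that have the KL property at every point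
of `dom (∂f)`. -/
structure IsKLFunction (f : E → EReal) : Prop where
  ne_bot : ∀ x, f x ≠ ⊥
  exists_ne_top : ∃ x, f x ≠ ⊤
  lowerSemicontinuous : LowerSemicontinuous f
  hasKLProperty : ∀ x, (subdifferential f x).Nonempty → HasKLProperty f x

/-- The KL property at a point with exponent `α`: one may take `φ s = μ₁ * s ^ (1 - α)`. -/
def HasKLExponent (f : E → EReal) (x₀ : E) (α : ℝ) : Prop :=
  ∃ μ₁ : ℝ, 0 < μ₁ ∧ HasKLPropertyWith f x₀ (fun s => μ₁ * s ^ (1 - α))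

end Subdifferential

/-! ### Tensors and the transformed singular values -/

/-- Real `n₁ × n₂ × n₃` tensors, with the Frobenius norm and inner product. -/
abbrev Tensor (n₁ n₂ n₃ : ℕ) : Type := EuclideanSpace ℝ (Fin n₁ × Fin n₂ × Fin n₃)

variable {n₁ n₂ n₃ : ℕ}

/-- The `k`-th frontal slice of the transformed tensor `U[X] = Fold₃ (U X₍₃₎)`. -/
def transformedSlice (U : Matrix.unitaryGroup (Fin n₃) ℂ) (X : Tensor n₁ n₂ n₃) (k : Fin n₃) :
    Matrix (Fin n₁) (Fin n₂) ℂ :=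
  Matrix.of fun i j => ∑ l, (U : Matrix (Fin n₃) (Fin n₃) ℂ) k l * ((X (i, j, l) : ℝ) : ℂ)

/-- The singular values of a matrix in decreasing order, indexed from `0`. -/
def singularValue (A : Matrix (Fin n₁) (Fin n₂) ℂ) (j : ℕ) : ℝ :=
  (Matrix.toEuclideanLin A).singularValues j

/-- The sum of `s (σ_j)` over all singular values `σ_j`, `j < min n₁ n₂`, of all frontal slices
of `U[X]`. For `s = g, s₁, s₂` this is `G_λ, S₁, S₂`. -/
def spectralSum (U : Matrix.unitaryGroup (Fin n₃) ℂ) (s : ℝ → ℝ) (X : Tensor n₁ n₂ n₃) : ℝ :=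
  ∑ k, ∑ j ∈ Finset.range (min n₁ n₂), s (singularValue (transformedSlice U X k) j)

/-- The set `D` of the tensors whose largest entry in absolute value is at most `c`
(the norm of the underlying function is the sup norm). -/
def box (n₁ n₂ n₃ : ℕ) (c : ℝ) : Set (Tensor n₁ n₂ n₃) :=
  {X | ‖WithLp.ofLp X‖ ≤ c}

open scoped Classical in
/-- The indicator function of a set in the sense of convex analysis. -/
def indicator {E : Type*} (D : Set E) (X : E) : EReal :=
  if X ∈ D then 0 else ⊤

/-! ### Assumptions on the regularizer -/

/-- The standing assumptions on the nonconvex function `g = g_λ`. -/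
structure IsRegularizer (lam : ℝ) (g : ℝ → ℝ) : Prop where
  nonneg : ∀ x, 0 ≤ g x
  symm : ∀ x, g (-x) = g x
  concaveOn : ConcaveOn ℝ (Ici 0) g
  monotoneOn : MonotoneOn g (Ici 0)
  map_zero : g 0 = 0
  antitoneOn_div : AntitoneOn (fun x => g x / x) (Ioi 0)
  differentiableAt : ∀ x, x ≠ 0 → DifferentiableAt ℝ g x
  deriv_bound : ∃ k₀ : ℝ, 0 < k₀ ∧ Tendsto (deriv g) (𝓝[>] 0) (𝓝 (lam * k₀)) ∧
    ∀ x, 0 < x → deriv g x ≤ lam * k₀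
  weaklyConvex : ∃ μ : ℝ, 0 < μ ∧ ConvexOn ℝ (Ioi 0) (fun x => g x + μ / 2 * x ^ 2)

/-- A decomposition `g = s₁ - s₂` into convex functions, where `s₂` is symmetric and
differentiable with a locally Lipschitz derivative. -/
structure IsDCDecomposition (g s₁ s₂ : ℝ → ℝ) : Prop where
  eq_sub : ∀ x, g x = s₁ x - s₂ x
  convex_fst : ConvexOn ℝ univ s₁
  convex_snd : ConvexOn ℝ univ s₂
  symm_snd : ∀ x, s₂ (-x) = s₂ x
  differentiable_snd : Differentiable ℝ s₂
  locallyLipschitz_deriv_snd : LocallyLipschitz (deriv s₂)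

/-! ### The objective and the algorithm -/

/-- The objective `H = f + β G_λ + δ_D`. -/
def objective (U : Matrix.unitaryGroup (Fin n₃) ℂ) (f : Tensor n₁ n₂ n₃ → ℝ) (g : ℝ → ℝ)
    (β c : ℝ) (X : Tensor n₁ n₂ n₃) : EReal :=
  ((f X + β * spectralSum U g X : ℝ) : EReal) + indicator (box n₁ n₂ n₃ c) X

/-- The proximal majorization `Q(X, Y)` of the objective at `Y`. -/
def majorant (U : Matrix.unitaryGroup (Fin n₃) ℂ) (f : Tensor n₁ n₂ n₃ → ℝ) (s₁ s₂ : ℝ → ℝ)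
    (β c ρ : ℝ) (X Y : Tensor n₁ n₂ n₃) : EReal :=
  ((f Y + inner ℝ (gradient f Y) (X - Y) + ρ / 2 * ‖X - Y‖ ^ 2
      + β * spectralSum U s₁ X - β * spectralSum U s₂ Y
      - β * inner ℝ (gradient (spectralSum U s₂) Y) (X - Y) : ℝ) : EReal)
    + indicator (box n₁ n₂ n₃ c) X

/-- `X` is a sequence generated by the inexact PMM algorithm: for every `t` there is
`W ∈ ∂Q(·, X t)` at `X (t + 1)` with `‖W‖ ≤ ξ ρ ‖X (t + 1) - X t‖`. -/
def IsPMMSequence (U : Matrix.unitaryGroup (Fin n₃) ℂ) (f : Tensor n₁ n₂ n₃ → ℝ) (s₁ s₂ : ℝ → ℝ)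
    (β c ρ ξ : ℝ) (X : ℕ → Tensor n₁ n₂ n₃) : Prop :=
  ∀ t, ∃ W ∈ subdifferential (fun Z => majorant U f s₁ s₂ β c ρ Z (X t)) (X (t + 1)),
    ‖W‖ ≤ ξ * ρ * ‖X (t + 1) - X t‖

end PMM

end

noncomputable section

namespace PMM

/-! ### Supporting lines -/

/-! The iterates form a descent sequence in the sense of Kurdyka-Lojasiewicz analysis: each step
decreases the objective by a multiple of its squared length, and the objective has a subgradient at
the new iterate of size at most a multiple of the step. The KL inequality with exponent `α` then
bounds the gap to the power `α` by the last step. Concavity of `s ^ (1 - α)` makes the step lengths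
nearly telescope, which traps the sequence near the cluster point and forces convergence. Combining
decrease and KL gives `h (t + 1) + κ * h (t + 1) ^ (2 * α) ≤ h t`, from which the rates follow
(`exists_isKLDescent`, `IsKLDescent.exists_recursion`).

The matrix-analytic input is that a spectral sum of an even convex function is convex, and that its
gradient exists and is Lipschitz on balls if the scalar derivative is locally Lipschitz. No
derivative formula for singular values is used. A majorization inequality (`sum_map_re_inner_le`)
yields a subgradient of the spectral sum as soon as the scalar function has supporting lines on an
interval containing the singular values. This applies to `s` and also to `K / 2 * x ^ 2 - s x`,
whose spectral sum is `K / 2 * ‖X‖ ^ 2` minus that of `s`. So the spectral sum lies between an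
affine function and the same kind of function plus a quadratic, and such bounds give
differentiability and a Lipschitz gradient.

In the difference between the objective and the majorant the nonsmooth spectral sum of `s₁` cancels.
Hence a subgradient of the convex majorant plus the gradient of a smooth function is a subgradient
of the objective. -/

/-- `s` restricted to `[-R, R]` has a supporting line at every point. -/
def HasSupportingLines (s : ℝ → ℝ) (R : ℝ) : Prop :=
  ∀ x ∈ Icc (-R) R, ∃ m, ∀ y ∈ Icc (-R) R, s x + m * (y - x) ≤ s y

theorem exists_supporting_line {s : ℝ → ℝ} (hs : ConvexOn ℝ univ s) (x : ℝ) :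
    ∃ m, ∀ y, s x + m * (y - x) ≤ s y := by
  refine ⟨derivWithin s (Ioi x) x, fun y => ?_⟩
  have hx : x ∈ interior (univ : Set ℝ) := by simp
  rcases lt_trichotomy x y with h | h | h
  · have := hs.rightDeriv_le_slope_of_mem_interior hx (mem_univ y) h
    rw [slope_def_field, le_div_iff₀ (by linarith)] at this
    linarith
  · simp [h]
  · have h1 := hs.slope_le_leftDeriv_of_mem_interior (mem_univ y) hx h
    have h2 := hs.leftDeriv_le_rightDeriv_of_mem_interior hx
    have h3 := h1.trans h2
    rw [slope_def_field, div_le_iff₀ (by linarith)] at h3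
    nlinarith

theorem hasSupportingLines_of_convexOn {s : ℝ → ℝ} (hs : ConvexOn ℝ univ s) (R : ℝ) :
    HasSupportingLines s R := fun x _ =>
  (exists_supporting_line hs x).imp fun _ hm y _ => hm y

/-- The slope of the supporting line at `0` cancels when the inequalities at `x` and `-x` are added.
-/
theorem HasSupportingLines.nonneg {s : ℝ → ℝ} {R : ℝ} (hs : HasSupportingLines s R)
    (hsymm : ∀ x, s (-x) = s x) (h0 : s 0 = 0) {x : ℝ} (hx : x ∈ Icc (-R) R) : 0 ≤ s x := by
  obtain ⟨m, hm⟩ := hs 0 ⟨by linarith [hx.1, hx.2], by linarith [hx.1, hx.2]⟩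
  have h1 := hm x hx
  have h2 := hm (-x) ⟨by linarith [hx.2], by linarith [hx.1]⟩
  rw [hsymm] at h2
  linarith

/-- A Jensen-type inequality with substochastic weights for symmetric functions. -/
theorem HasSupportingLines.le_sum {ι : Type*} [Fintype ι] {s : ℝ → ℝ} {R : ℝ}
    (hs : HasSupportingLines s R) (hsymm : ∀ x, s (-x) = s x) (h0 : s 0 = 0) {a σ : ι → ℝ} {b : ℝ}
    (ha : ∀ k, 0 ≤ a k) (hasum : ∑ k, a k ≤ 1) (hσ : ∀ k, 0 ≤ σ k) (hσR : ∀ k, σ k ≤ R)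
    (hR : 0 ≤ R) (hb : |b| ≤ ∑ k, a k * σ k) : s b ≤ ∑ k, a k * s (σ k) := by
  have hbR : |b| ≤ R := by
    calc |b| ≤ ∑ k, a k * σ k := hb
      _ ≤ ∑ k, a k * R := by gcongr with k; exacts [ha k, hσR k]
      _ = (∑ k, a k) * R := by rw [Finset.sum_mul]
      _ ≤ R := by nlinarith
  obtain ⟨m, hm⟩ := hs b (abs_le.1 hbR)
  -- By symmetry the line at `b` may be tested at `σ k` and at `-σ k`, so its slope can be replaced
  -- by `|m|`.
  have hk : ∀ k, s b - m * b + |m| * σ k ≤ s (σ k) := by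
    intro k
    have h1 := hm (σ k) ⟨by linarith [hσ k], hσR k⟩
    have h2 := hm (-σ k) ⟨by linarith [hσR k], by linarith [hσ k]⟩
    rw [hsymm] at h2
    rcases abs_cases m with ⟨h, _⟩ | ⟨h, _⟩ <;> rw [h] <;> linarith
  -- The intercept is nonpositive, so weights of total mass at most one suffice where Jensen's
  -- inequality needs mass one.
  have h00 : s b - m * b ≤ 0 := by
    have := hm 0 ⟨by linarith, hR⟩
    rw [h0] at this
    linarith
  calc s b ≤ (s b - m * b) + |m| * |b| := by
        have := le_abs_self (m * b)
        rw [abs_mul] at this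
        linarith
    _ ≤ (∑ k, a k) * (s b - m * b) + |m| * ∑ k, a k * σ k := by
        gcongr
        nlinarith
    _ = ∑ k, a k * (s b - m * b + |m| * σ k) := by
        simp only [mul_add, Finset.sum_add_distrib, Finset.sum_mul, Finset.mul_sum]
        congr 1
        exact Finset.sum_congr rfl fun k _ => by ring
    _ ≤ ∑ k, a k * s (σ k) := by
        gcongr with k
        exacts [ha k, hk k]

/-! ### Singular value decomposition -/

section SVD

open Module

variable {E F : Type*} [NormedAddCommGroup E] [InnerProductSpace ℂ E]
  [NormedAddCommGroup F] [InnerProductSpace ℂ F] {n : ℕ}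

local notation "⟪" x ", " y "⟫" => inner ℂ x y

/-- Bessel's inequality for a finite family of vectors. -/
def IsBessel {ι : Type*} [Fintype ι] (u : ι → F) : Prop :=
  ∀ v, ∑ j, ‖⟪u j, v⟫‖ ^ 2 ≤ ‖v‖ ^ 2

theorem IsBessel.norm_le_one {ι : Type*} [Fintype ι] {u : ι → F} (hu : IsBessel u) (j : ι) :
    ‖u j‖ ≤ 1 := by
  have h := (Finset.single_le_sum (f := fun i => ‖⟪u i, u j⟫‖ ^ 2) (fun i _ => by positivity)
    (Finset.mem_univ j)).trans (hu (u j))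
  simp only [inner_self_eq_norm_sq_to_K, norm_pow] at h
  simp only [Complex.coe_algebraMap, Complex.norm_real, norm_norm] at h
  by_contra! hlt
  nlinarith [sq_nonneg (‖u j‖ ^ 2), mul_pos (by positivity : 0 < ‖u j‖ ^ 2)
    (by nlinarith : 0 < ‖u j‖ ^ 2 - 1)]

theorem isBessel_orthonormalBasis {ι : Type*} [Fintype ι] (b : OrthonormalBasis ι ℂ E) :
    IsBessel b := fun v => (b.sum_sq_norm_inner_right v).le

variable [FiniteDimensional ℂ E] [FiniteDimensional ℂ F]

/-- A singular value decomposition indexed by the domain dimension: `y` is an eigenbasis of `T* T`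
and `x` consists of the normalized images. Where the singular value vanishes, `x j` is zero, so `x`
is only a Bessel family, but it need not be extended to a basis of `F`. -/
theorem exists_singular_frame (T : E →ₗ[ℂ] F) (hn : finrank ℂ E = n) :
    ∃ (x : Fin n → F) (y : OrthonormalBasis (Fin n) ℂ E), IsBessel x ∧
      ∀ j, T (y j) = (T.singularValues j : ℂ) • x j ∧
        ⟪x j, T (y j)⟫ = (T.singularValues j : ℂ) := by
  set y := T.isSymmetric_adjoint_comp_self.eigenvectorBasis hn with hy
  set σ : Fin n → ℝ := fun j => T.singularValues j with hσ
  have hT : ∀ i j, ⟪T (y i), T (y j)⟫ = if i = j then (σ j : ℂ) ^ 2 else 0 := by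
    intro i j
    have h1 := T.isSymmetric_adjoint_comp_self.apply_eigenvectorBasis hn j
    rw [← T.sq_singularValues_fin hn j] at h1
    rw [← LinearMap.adjoint_inner_right]
    rw [LinearMap.comp_apply] at h1
    rw [h1, inner_smul_right, ← hy, orthonormal_iff_ite.1 y.orthonormal i j]
    split_ifs <;> simp [hσ]
  have hT0 : ∀ j, σ j = 0 → T (y j) = 0 := by
    intro j hj
    rw [← inner_self_eq_zero (𝕜 := ℂ), hT]
    simp [hj]
  refine ⟨fun j => ((σ j)⁻¹ : ℂ) • T (y j), y, ?_, fun j => ⟨?_, ?_⟩⟩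
  · intro v
    have ho : Orthonormal ℂ (fun j : {j : Fin n // σ j ≠ 0} => ((σ j)⁻¹ : ℂ) • T (y j)) := by
      rw [orthonormal_iff_ite]
      rintro ⟨i, hi⟩ ⟨j, hj⟩
      simp only [inner_smul_left, inner_smul_right, hT, Subtype.mk.injEq]
      split_ifs with h
      · subst h
        have : (σ i : ℂ) ≠ 0 := by exact_mod_cast hi
        simp
        field_simp
      · simp
    have := ho.sum_inner_products_le v (s := Finset.univ)
    refine le_trans (le_of_eq ?_) this
    rw [← Finset.sum_subtype (Finset.univ.filter fun j => σ j ≠ 0) (by simp)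
      (fun j => ‖⟪((σ j)⁻¹ : ℂ) • T (y j), v⟫‖ ^ 2)]
    refine (Finset.sum_filter_of_ne (p := fun j => σ j ≠ 0) fun j _ hj hj0 => hj ?_).symm
    simp [hj0]
  · by_cases hj : σ j = 0
    · simp [hT0 j hj]
    · have : (σ j : ℂ) ≠ 0 := by exact_mod_cast hj
      rw [smul_smul, mul_inv_cancel₀ this, one_smul]
  · rw [inner_smul_left, hT]
    by_cases hj : σ j = 0
    · change _ = (σ j : ℂ)
      simp [hj]
    · have : (σ j : ℂ) ≠ 0 := by exact_mod_cast hj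
      simp only [if_true, map_inv₀, Complex.conj_ofReal]
      field_simp
      simp [hσ]

/-- The diagonal entries of `T` in two Bessel families are dominated by a doubly substochastic
average of the singular values. Row sums at most one allow the Jensen-type bound, and column sums at
most one allow summation because `s` is nonnegative. -/
theorem sum_map_re_inner_le {s : ℝ → ℝ} {R : ℝ} (hs : HasSupportingLines s R)
    (hsymm : ∀ x, s (-x) = s x) (h0 : s 0 = 0) (hR : 0 ≤ R) (T : E →ₗ[ℂ] F)
    (hn : finrank ℂ E = n) (hT : ∀ j, T.singularValues j ≤ R) {ι : Type*} [Fintype ι]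
    {u : ι → F} {v : ι → E} (hu : IsBessel u) (hv : IsBessel v) :
    (∀ j, |(⟪u j, T (v j)⟫).re| ≤ R) ∧
    ∑ j, s (⟪u j, T (v j)⟫).re ≤ ∑ k : Fin n, s (T.singularValues k) := by
  obtain ⟨x, y, hx, hxy⟩ := exists_singular_frame T hn
  set σ : Fin n → ℝ := fun k => T.singularValues k with hσ
  have hσ0 : ∀ k, 0 ≤ σ k := fun k => T.singularValues_nonneg k
  have hσR : ∀ k, σ k ≤ R := fun k => hT k
  -- The coefficient of `σ k` in an entry is a product of two overlaps. The AM-GM inequality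
  -- replaces it by this mean of squares, to which Bessel's inequality applies in both indices.
  set a : ι → Fin n → ℝ := fun j k => (‖⟪u j, x k⟫‖ ^ 2 + ‖⟪y k, v j⟫‖ ^ 2) / 2 with ha
  have ha0 : ∀ j k, 0 ≤ a j k := fun j k => by positivity
  have hrow : ∀ j, ∑ k, a j k ≤ 1 := by
    intro j
    have h1 := hx (u j)
    have h2 := isBessel_orthonormalBasis y (v j)
    have h3 := hu.norm_le_one j
    have h4 := hv.norm_le_one j
    simp only [ha, ← Finset.sum_div, Finset.sum_add_distrib]
    simp_rw [norm_inner_symm (u j)]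
    nlinarith [norm_nonneg (u j), norm_nonneg (v j)]
  have hcol : ∀ k, ∑ j, a j k ≤ 1 := by
    intro k
    have h1 := hu (x k)
    have h2 := hv (y k)
    have h3 := hx.norm_le_one k
    have h4 := (isBessel_orthonormalBasis y).norm_le_one k
    simp only [ha, ← Finset.sum_div, Finset.sum_add_distrib]
    simp_rw [norm_inner_symm (y k)]
    nlinarith [norm_nonneg (x k), norm_nonneg (y k)]
  have hb : ∀ j, |(⟪u j, T (v j)⟫).re| ≤ ∑ k, a j k * σ k := by
    intro j
    have h1 : ⟪u j, T (v j)⟫ = ∑ k, ⟪y k, v j⟫ * σ k * ⟪u j, x k⟫ := by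
      conv_lhs => rw [← y.sum_repr' (v j)]
      simp only [map_sum, map_smul, inner_sum, inner_smul_right, (hxy _).1, mul_assoc, hσ]
    rw [h1]
    refine (Complex.abs_re_le_norm _).trans ((norm_sum_le _ _).trans ?_)
    refine Finset.sum_le_sum fun k _ => ?_
    rw [norm_mul, norm_mul, Complex.norm_real, Real.norm_of_nonneg (hσ0 k)]
    simp only [ha]
    nlinarith [mul_nonneg (hσ0 k) (sq_nonneg (‖⟪u j, x k⟫‖ - ‖⟪y k, v j⟫‖))]
  refine ⟨fun j => ?_, ?_⟩
  · calc |(⟪u j, T (v j)⟫).re| ≤ ∑ k, a j k * σ k := hb j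
      _ ≤ ∑ k, a j k * R := by gcongr with k; exact hσR k
      _ = (∑ k, a j k) * R := by rw [Finset.sum_mul]
      _ ≤ R := by nlinarith [hrow j]
  · calc ∑ j, s (⟪u j, T (v j)⟫).re ≤ ∑ j, ∑ k, a j k * s (σ k) := by
          gcongr with j
          exact hs.le_sum hsymm h0 (ha0 j) (hrow j) hσ0 hσR hR (hb j)
      _ = ∑ k, (∑ j, a j k) * s (σ k) := by
          rw [Finset.sum_comm]
          simp only [Finset.sum_mul]
      _ ≤ ∑ k, s (σ k) := by
          refine Finset.sum_le_sum fun k _ => ?_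
          have := hs.nonneg hsymm h0 (x := σ k) ⟨by linarith [hσ0 k], hσR k⟩
          nlinarith [hcol k]

/-- A sum of symmetric convex functions of the singular values has a subgradient. -/
theorem exists_singularValues_subgradient {s : ℝ → ℝ} {R : ℝ} (hs : HasSupportingLines s R)
    (hsymm : ∀ x, s (-x) = s x) (h0 : s 0 = 0) (T : E →ₗ[ℂ] F)
    (hn : finrank ℂ E = n) (hT : ∀ j, T.singularValues j ≤ R) :
    ∃ l : (E →ₗ[ℂ] F) →ₗ[ℝ] ℝ, ∀ T' : E →ₗ[ℂ] F, (∀ j, T'.singularValues j ≤ R) →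
      ∑ k : Fin n, s (T.singularValues k) + l (T' - T) ≤ ∑ k : Fin n, s (T'.singularValues k) := by
  obtain ⟨x, y, hx, hxy⟩ := exists_singular_frame T hn
  have hR : 0 ≤ R := (T.singularValues_nonneg 0).trans (hT 0)
  have hm := fun j : Fin n => hs (T.singularValues j)
    ⟨by linarith [T.singularValues_nonneg j], hT j⟩
  choose m hm using hm
  -- The scalar slopes are placed on the singular frame of `T`. The diagonal of `T` in this frame is
  -- exactly its singular values, while for `T'` the majorization inequality bounds the diagonal
  -- sum.
  refine ⟨{ toFun := fun B => ∑ j, m j * (⟪x j, B (y j)⟫).re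
            map_add' := fun A B => ?_
            map_smul' := fun r B => ?_ }, fun T' hT' => ?_⟩
  · simp [mul_add, Finset.sum_add_distrib]
  · simp only [LinearMap.smul_apply, RingHom.id_apply, smul_eq_mul, Finset.mul_sum]
    refine Finset.sum_congr rfl fun j _ => ?_
    rw [← Complex.coe_smul, inner_smul_right, Complex.re_ofReal_mul]
    ring
  · obtain ⟨h1, h2⟩ := sum_map_re_inner_le hs hsymm h0 hR T' hn hT' hx (isBessel_orthonormalBasis y)
    refine le_trans ?_ h2
    simp only [LinearMap.coe_mk, AddHom.coe_mk]
    rw [← Finset.sum_add_distrib]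
    refine Finset.sum_le_sum fun j _ => ?_
    have := hm j _ (abs_le.1 (h1 j))
    rwa [LinearMap.sub_apply, inner_sub_right, (hxy j).2, Complex.sub_re, Complex.ofReal_re]

/-- Parseval's identity in both spaces. The right side does not involve `b`, so the Hilbert-Schmidt
norm is independent of the basis. -/
theorem sum_sq_norm_map_orthonormalBasis {ι κ : Type*} [Fintype ι] [Fintype κ] (T : E →ₗ[ℂ] F)
    (b : OrthonormalBasis ι ℂ E) (e : OrthonormalBasis κ ℂ F) :
    ∑ i, ‖T (b i)‖ ^ 2 = ∑ k, ‖LinearMap.adjoint T (e k)‖ ^ 2 := by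
  calc ∑ i, ‖T (b i)‖ ^ 2 = ∑ i, ∑ k, ‖⟪e k, T (b i)⟫‖ ^ 2 := by
        simp only [e.sum_sq_norm_inner_right]
    _ = ∑ k, ∑ i, ‖⟪LinearMap.adjoint T (e k), b i⟫‖ ^ 2 := by
        rw [Finset.sum_comm]
        simp only [LinearMap.adjoint_inner_left]
    _ = _ := by simp only [b.sum_sq_norm_inner_left]

theorem sum_sq_singularValues {ι : Type*} [Fintype ι] (T : E →ₗ[ℂ] F) (hn : finrank ℂ E = n)
    (b : OrthonormalBasis ι ℂ E) :
    ∑ j : Fin n, T.singularValues j ^ 2 = ∑ i, ‖T (b i)‖ ^ 2 := by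
  set y := T.isSymmetric_adjoint_comp_self.eigenvectorBasis hn with hy
  have h2 : ∀ j : Fin n, T.singularValues j ^ 2 = ‖T (y j)‖ ^ 2 := by
    intro j
    have h1 := T.isSymmetric_adjoint_comp_self.apply_eigenvectorBasis hn j
    rw [← T.sq_singularValues_fin hn j, LinearMap.comp_apply, ← hy] at h1
    have h3 : ⟪T (y j), T (y j)⟫ = (T.singularValues j : ℂ) ^ 2 := by
      rw [← LinearMap.adjoint_inner_right, h1, inner_smul_right, inner_self_eq_norm_sq_to_K]
      simp
    rw [inner_self_eq_norm_sq_to_K] at h3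
    simp only [Complex.coe_algebraMap] at h3
    exact_mod_cast h3.symm
  rw [Finset.sum_congr rfl fun j _ => h2 j, 
    sum_sq_norm_map_orthonormalBasis T y (stdOrthonormalBasis ℂ F),
    sum_sq_norm_map_orthonormalBasis T b (stdOrthonormalBasis ℂ F)]

end SVD

/-! ### Spectral sums of tensors -/

section SpectralSum

variable {n₁ n₂ n₃ : ℕ} (U : Matrix.unitaryGroup (Fin n₃) ℂ)

/-- The operator of the `k`-th transformed frontal slice, as a linear function of the tensor. -/
def sliceOperator (k : Fin n₃) : Tensor n₁ n₂ n₃ →ₗ[ℝ]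
    (EuclideanSpace ℂ (Fin n₂) →ₗ[ℂ] EuclideanSpace ℂ (Fin n₁)) where
  toFun X := Matrix.toEuclideanLin (transformedSlice U X k)
  map_add' X Y := by
    rw [← map_add]
    congr 1
    ext i j
    simp [transformedSlice, mul_add, Finset.sum_add_distrib]
  map_smul' r X := by
    have : transformedSlice U (r • X) k = (r : ℂ) • transformedSlice U X k := by
      ext i j
      simp only [transformedSlice, Matrix.of_apply, Matrix.smul_apply, PiLp.smul_apply, smul_eq_mul,
        Finset.mul_sum, Complex.ofReal_mul]
      exact Finset.sum_congr rfl fun l _ => by ring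
    rw [this, map_smul, RingHom.id_apply, Complex.coe_smul]

theorem singularValue_transformedSlice (X : Tensor n₁ n₂ n₃) (k : Fin n₃) (j : ℕ) :
    singularValue (transformedSlice U X k) j = (sliceOperator U k X).singularValues j := rfl

/-- The rank is at most `n₁`, so the singular values added beyond `min n₁ n₂` are zero and
contribute `s 0 = 0`. -/
theorem spectralSum_eq {s : ℝ → ℝ} (h0 : s 0 = 0) (X : Tensor n₁ n₂ n₃) :
    spectralSum U s X = ∑ k, ∑ j : Fin n₂, s ((sliceOperator U k X).singularValues j) := by
  refine Finset.sum_congr rfl fun k _ => ?_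
  simp only [singularValue_transformedSlice]
  rw [Fin.sum_univ_eq_sum_range (fun j => s ((sliceOperator U k X).singularValues j))]
  refine Finset.sum_subset (Finset.range_mono (min_le_right _ _)) fun j hj hj' => ?_
  have h1 : n₁ ≤ j := by
    simp only [Finset.mem_range] at hj hj'
    omega
  have h2 := (LinearMap.range (sliceOperator (n₁ := n₁) (n₂ := n₂) U k X)).finrank_le
  rw [(LinearMap.singularValues_eq_zero_iff_le_finrank_range _).2, h0]
  simp only [finrank_euclideanSpace, Fintype.card_fin] at h2
  omega

/-- The squared singular values of a slice sum to its squared Frobenius norm, and the unitary `U`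
preserves the norm of each tube `X (i, j, ·)`. -/
theorem sum_sq_singularValues_sliceOperator (X : Tensor n₁ n₂ n₃) :
    ∑ k, ∑ j : Fin n₂, (sliceOperator U k X).singularValues j ^ 2 = ‖X‖ ^ 2 := by
  have h1 : ∀ k, ∑ j : Fin n₂, (sliceOperator U k X).singularValues j ^ 2 =
      ∑ j, ∑ i, ‖transformedSlice U X k i j‖ ^ 2 := by
    intro k
    rw [sum_sq_singularValues _ (by simp) (EuclideanSpace.basisFun (Fin n₂) ℂ)]
    refine Finset.sum_congr rfl fun j _ => ?_
    rw [EuclideanSpace.norm_sq_eq]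
    refine Finset.sum_congr rfl fun i _ => ?_
    simp [sliceOperator, Matrix.toEuclideanLin]
  have h2 : ∀ (j : Fin n₂) (i : Fin n₁),
      ∑ k, ‖transformedSlice U X k i j‖ ^ 2 = ∑ l, X (i, j, l) ^ 2 := by
    intro j i
    let v : EuclideanSpace ℂ (Fin n₃) := WithLp.toLp 2 fun l => ((X (i, j, l) : ℝ) : ℂ)
    have hU : ‖Matrix.toEuclideanLin (U : Matrix (Fin n₃) (Fin n₃) ℂ) v‖ ^ 2 = ‖v‖ ^ 2 := by
      have hUU : (U : Matrix (Fin n₃) (Fin n₃) ℂ).conjTranspose * U = 1 :=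
        Matrix.mem_unitaryGroup_iff'.1 U.2
      have h3 : inner ℂ (Matrix.toEuclideanLin (U : Matrix (Fin n₃) (Fin n₃) ℂ) v)
          (Matrix.toEuclideanLin (U : Matrix (Fin n₃) (Fin n₃) ℂ) v) = inner ℂ v v := by
        rw [← LinearMap.adjoint_inner_left, ← Matrix.toEuclideanLin_conjTranspose_eq_adjoint]
        congr 1
        simp only [Matrix.toEuclideanLin, Matrix.toLpLin_apply]
        simp [Matrix.mulVec_mulVec, hUU]
      rw [inner_self_eq_norm_sq_to_K, inner_self_eq_norm_sq_to_K] at h3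
      simp only [Complex.coe_algebraMap] at h3
      exact_mod_cast h3
    rw [EuclideanSpace.norm_sq_eq, EuclideanSpace.norm_sq_eq] at hU
    calc ∑ k, ‖transformedSlice U X k i j‖ ^ 2
        = ∑ k, ‖Matrix.toEuclideanLin (U : Matrix (Fin n₃) (Fin n₃) ℂ) v k‖ ^ 2 := by
          refine Finset.sum_congr rfl fun k _ => ?_
          simp [transformedSlice, v, Matrix.toEuclideanLin, Matrix.mulVec, dotProduct]
      _ = _ := by
          rw [hU]
          refine Finset.sum_congr rfl fun k _ => ?_
          simp [v]
  simp only [h1]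
  rw [EuclideanSpace.norm_sq_eq, Finset.sum_comm, Fintype.sum_prod_type]
  simp only [Fintype.sum_prod_type]
  rw [Finset.sum_comm (s := (Finset.univ : Finset (Fin n₁)))]
  refine Finset.sum_congr rfl fun j _ => ?_
  rw [Finset.sum_comm]
  refine Finset.sum_congr rfl fun i _ => ?_
  rw [h2]
  simp

theorem singularValues_sliceOperator_le (X : Tensor n₁ n₂ n₃) (k : Fin n₃) (j : ℕ) :
    (sliceOperator U k X).singularValues j ≤ ‖X‖ := by
  by_cases hj : j < n₂
  · have h1 : (sliceOperator U k X).singularValues j ^ 2 ≤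
        ∑ i : Fin n₂, (sliceOperator U k X).singularValues i ^ 2 :=
      Finset.single_le_sum (f := fun i : Fin n₂ => (sliceOperator U k X).singularValues i ^ 2)
        (fun i _ => sq_nonneg _) (Finset.mem_univ ⟨j, hj⟩)
    have h2 : ∑ i : Fin n₂, (sliceOperator U k X).singularValues i ^ 2 ≤
        ∑ k, ∑ i : Fin n₂, (sliceOperator U k X).singularValues i ^ 2 :=
      Finset.single_le_sum
        (f := fun k => ∑ i : Fin n₂, (sliceOperator U k X).singularValues i ^ 2)
        (fun i _ => Finset.sum_nonneg fun _ _ => sq_nonneg _) (Finset.mem_univ k)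
    rw [sum_sq_singularValues_sliceOperator] at h2
    exact le_of_sq_le_sq (h1.trans h2) (norm_nonneg X)
  · rw [LinearMap.singularValues_of_finrank_le _ (by simpa using hj)]
    exact norm_nonneg _

theorem spectralSum_sub (s t : ℝ → ℝ) (X : Tensor n₁ n₂ n₃) :
    spectralSum U (fun x => s x - t x) X = spectralSum U s X - spectralSum U t X := by
  simp [spectralSum, Finset.sum_sub_distrib]

theorem spectralSum_const (a : ℝ) (X Y : Tensor n₁ n₂ n₃) :
    spectralSum U (fun _ => a) X = spectralSum U (fun _ => a) Y := by
  simp [spectralSum]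

theorem spectralSum_mul_sq (a : ℝ) (X : Tensor n₁ n₂ n₃) :
    spectralSum U (fun x => a * x ^ 2) X = a * ‖X‖ ^ 2 := by
  rw [spectralSum_eq U (by simp), ← sum_sq_singularValues_sliceOperator U]
  simp only [Finset.mul_sum]

/-- A spectral sum of a symmetric function with supporting lines has a subgradient. -/
theorem exists_spectralSum_subgradient {s : ℝ → ℝ} {R : ℝ} (hs : HasSupportingLines s R)
    (hsymm : ∀ x, s (-x) = s x) {X : Tensor n₁ n₂ n₃} (hX : ‖X‖ ≤ R) :
    ∃ y : Tensor n₁ n₂ n₃, ∀ Z : Tensor n₁ n₂ n₃, ‖Z‖ ≤ R →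
      spectralSum U s X + inner ℝ y (Z - X) ≤ spectralSum U s Z := by
  -- Normalizing the value at `0` shifts the spectral sum by a constant independent of the tensor.
  set t : ℝ → ℝ := fun x => s x - s 0 with ht
  have htR : HasSupportingLines t R := fun x hx =>
    (hs x hx).imp fun m hm y hy => by simp only [ht]; linarith [hm y hy]
  have key := fun k : Fin n₃ => exists_singularValues_subgradient (n := n₂) htR
    (fun x => by simp [ht, hsymm]) (by simp [ht]) (sliceOperator U k X) (by simp)
    fun j => (singularValues_sliceOperator_le U X k j).trans hX
  choose l hl using key
  let φ : Tensor n₁ n₂ n₃ →ₗ[ℝ] ℝ := ∑ k, (l k) ∘ₗ sliceOperator U k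
  refine ⟨(InnerProductSpace.toDual ℝ _).symm (LinearMap.toContinuousLinearMap φ), fun Z hZ => ?_⟩
  rw [InnerProductSpace.toDual_symm_apply]
  have h1 : spectralSum U t X + φ (Z - X) ≤ spectralSum U t Z := by
    rw [spectralSum_eq U (by simp [ht]), spectralSum_eq U (by simp [ht])]
    simp only [φ, LinearMap.sum_apply, LinearMap.comp_apply, map_sub (sliceOperator U _)]
    rw [← Finset.sum_add_distrib]
    exact Finset.sum_le_sum fun k _ =>
      hl k _ fun j => (singularValues_sliceOperator_le U Z k j).trans hZ
  rw [ht, spectralSum_sub, spectralSum_sub, spectralSum_const U (s 0) X Z] at h1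
  simp only [LinearMap.coe_toContinuousLinearMap']
  linarith

/-- A subgradient at the convex combination, valid on a ball containing all three points, is
averaged over the endpoints. -/
theorem convexOn_spectralSum {s : ℝ → ℝ} (hs : ConvexOn ℝ univ s) (hsymm : ∀ x, s (-x) = s x) :
    ConvexOn ℝ univ (spectralSum U s : Tensor n₁ n₂ n₃ → ℝ) := by
  refine ⟨convex_univ, fun X _ Y _ a b ha hb hab => ?_⟩
  set W := a • X + b • Y
  set R := max (max ‖X‖ ‖Y‖) ‖W‖
  obtain ⟨y, hy⟩ := exists_spectralSum_subgradient U (hasSupportingLines_of_convexOn hs R) hsymm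
    (le_max_right _ _ : ‖W‖ ≤ R)
  have h1 := hy X ((le_max_left _ _).trans (le_max_left _ _))
  have h2 := hy Y ((le_max_right _ _).trans (le_max_left _ _))
  have h3 : a * inner ℝ y (X - W) + b * inner ℝ y (Y - W) = 0 := by
    have : a • (X - W) + b • (Y - W) = 0 := by
      simp only [smul_sub]
      rw [sub_add_sub_comm, ← add_smul, hab, one_smul, sub_self]
    rw [← inner_smul_right, ← inner_smul_right, ← inner_add_right, this, inner_zero_right]
  simp only [smul_eq_mul]
  calc spectralSum U s W = (a + b) * spectralSum U s W := by rw [hab, one_mul]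
    _ ≤ _ := by nlinarith [mul_le_mul_of_nonneg_left h1 ha, mul_le_mul_of_nonneg_left h2 hb]

theorem continuous_spectralSum {s : ℝ → ℝ} (hs : ConvexOn ℝ univ s) (hsymm : ∀ x, s (-x) = s x) :
    Continuous (spectralSum U s : Tensor n₁ n₂ n₃ → ℝ) :=
  (convexOn_spectralSum U hs hsymm).locallyLipschitz.continuous

end SpectralSum

/-! ### Smoothness from two-sided quadratic bounds -/

section Smooth

variable {E : Type*} [NormedAddCommGroup E] [InnerProductSpace ℝ E] [CompleteSpace E]

/-- The descent lemma: along the segment, `f` minus its quadratic upper model has nonpositive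
derivative. The set `C` serves both as an interval for the scalar function and as the whole tensor
space for `f`. -/
theorem le_add_inner_add_sq_of_lipschitz_gradient {f : E → ℝ} {f' : E → E} {C : Set E} {K : ℝ}
    (hC : Convex ℝ C) (hf : ∀ z ∈ C, HasGradientAt f (f' z) z)
    (hK : ∀ x ∈ C, ∀ y ∈ C, ‖f' x - f' y‖ ≤ K * ‖x - y‖) {x y : E} (hx : x ∈ C) (hy : y ∈ C) :
    f y ≤ f x + inner ℝ (f' x) (y - x) + K / 2 * ‖y - x‖ ^ 2 := by
  set d := y - x with hd
  have hmem : ∀ t ∈ Icc (0 : ℝ) 1, x + t • d ∈ C := fun t ht => hC.add_smul_sub_mem hx hy ht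
  have hder : ∀ t ∈ Icc (0 : ℝ) 1,
      HasDerivAt (fun t : ℝ => f (x + t • d) - t * inner ℝ (f' x) d - K / 2 * ‖d‖ ^ 2 * t ^ 2)
        (inner ℝ (f' (x + t • d)) d - inner ℝ (f' x) d - K * ‖d‖ ^ 2 * t) t := by
    intro t ht
    have h1 : HasDerivAt (fun t : ℝ => x + t • d) d t := by
      simpa using ((hasDerivAt_id t).smul_const d).const_add x
    have h2 := (hf _ (hmem t ht)).hasFDerivAt.comp_hasDerivAt t h1
    rw [InnerProductSpace.toDual_apply_apply] at h2
    have h3 := (hasDerivAt_id t).mul_const (inner ℝ (f' x) d)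
    have h4 := ((hasDerivAt_id t).pow 2).const_mul (K / 2 * ‖d‖ ^ 2)
    refine ((h2.sub h3).sub h4).congr_deriv ?_
    simp
    ring
  have hanti := antitoneOn_of_deriv_nonpos (convex_Icc (0 : ℝ) 1)
    (fun t ht => (hder t ht).continuousAt.continuousWithinAt)
    (fun t ht => (hder t (interior_subset ht)).differentiableAt.differentiableWithinAt)
    (fun t ht => by
      have ht' := interior_subset ht
      rw [(hder t ht').deriv, ← inner_sub_left]
      have h1 := real_inner_le_norm (f' (x + t • d) - f' x) d
      have h2 := hK _ (hmem t ht') x hx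
      rw [add_sub_cancel_left, norm_smul, Real.norm_of_nonneg ht'.1] at h2
      nlinarith [norm_nonneg d])
  have := hanti (left_mem_Icc.2 zero_le_one) (right_mem_Icc.2 zero_le_one) zero_le_one
  simp only [one_smul, zero_smul, add_zero, hd, add_sub_cancel] at this ⊢
  linarith

/-- Moving a distance of order `t` along `y - y'` and letting `t` tend to zero forces the two slopes
to agree. The remainder is then of second order. -/
theorem hasGradientAt_of_quadratic_bounds {φ : E → ℝ} {x y y' : E} {K : ℝ}
    (hlow : ∀ᶠ z in 𝓝 x, φ x + inner ℝ y (z - x) ≤ φ z)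
    (hup : ∀ᶠ z in 𝓝 x, φ z ≤ φ x + inner ℝ y' (z - x) + K / 2 * ‖z - x‖ ^ 2) :
    HasGradientAt φ y x ∧ y = y' := by
  have hyy : y = y' := by
    have h1 : Tendsto (fun t : ℝ => x + t • (y - y')) (𝓝[>] 0) (𝓝 x) := by
      have : Tendsto (fun t : ℝ => x + t • (y - y')) (𝓝 0) (𝓝 (x + (0 : ℝ) • (y - y'))) :=
        Continuous.tendsto (by fun_prop) 0
      simpa using this.mono_left nhdsWithin_le_nhds
    have h2 : ∀ᶠ t : ℝ in 𝓝[>] 0, ‖y - y'‖ ^ 2 ≤ K / 2 * ‖y - y'‖ ^ 2 * t := by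
      filter_upwards [h1.eventually hlow, h1.eventually hup, self_mem_nhdsWithin] with t h3 h4 h5
      have ht : 0 < t := h5
      rw [add_sub_cancel_left, inner_smul_right] at h3 h4
      rw [norm_smul, Real.norm_of_nonneg ht.le] at h4
      have h6 : t * (inner ℝ y (y - y') - inner ℝ y' (y - y')) ≤
          t * (K / 2 * ‖y - y'‖ ^ 2 * t) := by nlinarith
      rw [← inner_sub_left, real_inner_self_eq_norm_sq] at h6
      exact le_of_mul_le_mul_left h6 ht
    have h3 : Tendsto (fun t : ℝ => K / 2 * ‖y - y'‖ ^ 2 * t) (𝓝[>] 0) (𝓝 0) := by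
      have : Tendsto (fun t : ℝ => K / 2 * ‖y - y'‖ ^ 2 * t) (𝓝 0) (𝓝 (K / 2 * ‖y - y'‖ ^ 2 * 0)) :=
        Continuous.tendsto (by fun_prop) 0
      simpa using this.mono_left nhdsWithin_le_nhds
    have h4 := ge_of_tendsto h3 h2
    have h5 : ‖y - y'‖ = 0 := by nlinarith [norm_nonneg (y - y')]
    exact sub_eq_zero.1 (norm_eq_zero.1 h5)
  refine ⟨?_, hyy⟩
  rw [hasGradientAt_iff_isLittleO]
  have hO : (fun z => φ z - φ x - inner ℝ y (z - x)) =O[𝓝 x] fun z => ‖z - x‖ ^ 2 := by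
    refine Asymptotics.IsBigO.of_bound (K / 2) ?_
    filter_upwards [hlow, hup] with z h1 h2
    rw [← hyy] at h2
    rw [Real.norm_of_nonneg (by linarith), Real.norm_of_nonneg (by positivity)]
    linarith
  refine hO.trans_isLittleO ?_
  have h1 : Tendsto (fun z => z - x) (𝓝 x) (𝓝 0) := by
    simpa using (continuous_id.sub continuous_const).tendsto (f := fun z => z - x) x
  exact (Asymptotics.isLittleO_norm_pow_id (one_lt_two)).comp_tendsto h1

-- The lower bound at `y` and the upper bound at `x` are compared at `y + d`, where `d` has length
-- `‖x - y‖` and points along `gy - gx`. Since `‖d‖ ≤ 2 * R`, the bounds are needed on the ball of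
-- radius `3 * R`.
omit [CompleteSpace E] in
theorem norm_sub_le_of_quadratic_bounds {φ : E → ℝ} {x y gx gy : E} {K R : ℝ}
    (hx : ‖x‖ ≤ R) (hy : ‖y‖ ≤ R)
    (hlowx : φ x + inner ℝ gx (y - x) ≤ φ y)
    (hlowy : ∀ z, ‖z‖ ≤ 3 * R → φ y + inner ℝ gy (z - y) ≤ φ z)
    (hupx : ∀ z, ‖z‖ ≤ 3 * R → φ z ≤ φ x + inner ℝ gx (z - x) + K / 2 * ‖z - x‖ ^ 2)
    (hK : 0 ≤ K) (hxy : x ≠ y) : ‖gx - gy‖ ≤ 2 * K * ‖x - y‖ := by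
  rcases eq_or_ne gy gx with h | h
  · rw [h, sub_self, norm_zero]
    positivity
  set r := ‖x - y‖ with hr
  have hr0 : 0 < r := norm_pos_iff.2 (sub_ne_zero.2 hxy)
  have hn : 0 < ‖gy - gx‖ := norm_pos_iff.2 (sub_ne_zero.2 h)
  set d := (r / ‖gy - gx‖) • (gy - gx) with hd
  have hdr : ‖d‖ = r := by
    rw [hd, norm_smul, Real.norm_of_nonneg (by positivity)]
    field_simp
  have hrR : r ≤ 2 * R := (norm_sub_le x y).trans (by linarith)
  have hz : ‖y + d‖ ≤ 3 * R := (norm_add_le _ _).trans (by rw [hdr]; linarith)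
  have h1 := hlowy _ hz
  have h2 := hupx _ hz
  have h3 : ‖y + d - x‖ ≤ 2 * r := by
    rw [show y + d - x = d - (x - y) by abel]
    exact (norm_sub_le _ _).trans (by rw [hdr]; linarith)
  have h4 : inner ℝ gx (y + d - x) = inner ℝ gx d + inner ℝ gx (y - x) := by
    rw [← inner_add_right]
    congr 1
    abel
  have h5 : inner ℝ gy d - inner ℝ gx d = r * ‖gy - gx‖ := by
    rw [← inner_sub_left, hd, inner_smul_right, real_inner_self_eq_norm_sq]
    field_simp
  rw [add_sub_cancel_left] at h1
  have h6 : ‖y + d - x‖ ^ 2 ≤ (2 * r) ^ 2 := by gcongr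
  have h7 : r * ‖gy - gx‖ ≤ r * (2 * K * r) := by nlinarith
  rw [norm_sub_rev]
  exact le_of_mul_le_mul_left h7 hr0

end Smooth

/-! ### Smoothness of spectral sums -/

section SpectralSmooth

variable {n₁ n₂ n₃ : ℕ} (U : Matrix.unitaryGroup (Fin n₃) ℂ) {s : ℝ → ℝ}

/-- With `K` a Lipschitz constant of `deriv s` on `[-R, R]`, both `s` and `K / 2 * x ^ 2 - s x` have
supporting lines there. Their spectral subgradients give the lower and the upper bound, and the
sandwich identifies both slopes with the gradient. -/
theorem exists_spectralSum_quadratic_bounds (hs : ConvexOn ℝ univ s) (hsymm : ∀ x, s (-x) = s x)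
    (hd : Differentiable ℝ s) (hl : LocallyLipschitz (deriv s)) (R : ℝ) :
    ∃ K : ℝ, 0 ≤ K ∧ ∀ X : Tensor n₁ n₂ n₃, ‖X‖ < R →
      HasGradientAt (spectralSum U s) (gradient (spectralSum U s) X) X ∧
      ∀ Z : Tensor n₁ n₂ n₃, ‖Z‖ ≤ R →
        spectralSum U s X + inner ℝ (gradient (spectralSum U s) X) (Z - X) ≤ spectralSum U s Z ∧
        spectralSum U s Z ≤ spectralSum U s X + inner ℝ (gradient (spectralSum U s) X) (Z - X) +
          K / 2 * ‖Z - X‖ ^ 2 := by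
  obtain ⟨K, hK⟩ := hl.locallyLipschitzOn.exists_lipschitzOnWith_of_compact
    (isCompact_Icc : IsCompact (Icc (-R) R))
  refine ⟨K, K.2, fun X hX => ?_⟩
  obtain ⟨y, hy⟩ := exists_spectralSum_subgradient U (hasSupportingLines_of_convexOn hs R)
    hsymm hX.le
  have hψ : HasSupportingLines (fun x => K / 2 * x ^ 2 - s x) R := by
    intro x hx
    refine ⟨K * x - deriv s x, fun z hz => ?_⟩
    have := le_add_inner_add_sq_of_lipschitz_gradient (f := s) (f' := deriv s) (K := K)
      (convex_Icc (-R) R) (fun z _ => (hd z).hasDerivAt.hasGradientAt')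
      (fun a ha b hb => by simpa [Real.dist_eq] using hK.dist_le_mul a ha b hb) hx hz
    simp only [RCLike.inner_apply, conj_trivial, Real.norm_eq_abs, sq_abs] at this
    nlinarith
  obtain ⟨w, hw⟩ := exists_spectralSum_subgradient U hψ (fun x => by simp [hsymm]) hX.le
  have hup : ∀ Z : Tensor n₁ n₂ n₃, ‖Z‖ ≤ R → spectralSum U s Z ≤
      spectralSum U s X + inner ℝ ((K : ℝ) • X - w) (Z - X) + K / 2 * ‖Z - X‖ ^ 2 := by
    intro Z hZ
    have h1 := hw Z hZ
    rw [spectralSum_sub, spectralSum_sub, spectralSum_mul_sq, spectralSum_mul_sq] at h1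
    have h2 : ‖Z‖ ^ 2 = ‖X‖ ^ 2 + 2 * inner ℝ X (Z - X) + ‖Z - X‖ ^ 2 := by
      rw [← norm_add_sq_real, add_sub_cancel]
    rw [inner_sub_left, inner_smul_left, conj_trivial]
    rw [h2] at h1
    linarith
  have hnhds : ∀ᶠ Z : Tensor n₁ n₂ n₃ in 𝓝 X, ‖Z‖ ≤ R :=
    (continuous_norm.tendsto X).eventually (eventually_le_nhds hX)
  obtain ⟨h1, h2⟩ := hasGradientAt_of_quadratic_bounds (K := K)
    (hnhds.mono fun Z hZ => hy Z hZ) (hnhds.mono fun Z hZ => hup Z hZ)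
  rw [h1.gradient]
  exact ⟨h1, fun Z hZ => ⟨hy Z hZ, h2 ▸ hup Z hZ⟩⟩

theorem hasGradientAt_spectralSum (hs : ConvexOn ℝ univ s) (hsymm : ∀ x, s (-x) = s x)
    (hd : Differentiable ℝ s) (hl : LocallyLipschitz (deriv s)) (X : Tensor n₁ n₂ n₃) :
    HasGradientAt (spectralSum U s) (gradient (spectralSum U s) X) X := by
  obtain ⟨K, -, hK⟩ := exists_spectralSum_quadratic_bounds (n₁ := n₁) (n₂ := n₂) U hs hsymm hd hl
    (‖X‖ + 1)
  exact (hK X (lt_add_one _)).1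

theorem spectralSum_add_inner_gradient_le (hs : ConvexOn ℝ univ s) (hsymm : ∀ x, s (-x) = s x)
    (hd : Differentiable ℝ s) (hl : LocallyLipschitz (deriv s)) (X Z : Tensor n₁ n₂ n₃) :
    spectralSum U s X + inner ℝ (gradient (spectralSum U s) X) (Z - X) ≤ spectralSum U s Z := by
  obtain ⟨K, -, hK⟩ := exists_spectralSum_quadratic_bounds (n₁ := n₁) (n₂ := n₂) U hs hsymm hd hl
    (max ‖X‖ ‖Z‖ + 1)
  exact ((hK X ((le_max_left _ _).trans_lt (lt_add_one _))).2 Z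
    ((le_max_right _ _).trans (lt_add_one _).le)).1

/-- The gradient of a smooth spectral sum is Lipschitz on balls. -/
theorem exists_lipschitz_gradient_spectralSum (hs : ConvexOn ℝ univ s) (hsymm : ∀ x, s (-x) = s x)
    (hd : Differentiable ℝ s) (hl : LocallyLipschitz (deriv s)) (R : ℝ) :
    ∃ K : ℝ, 0 ≤ K ∧ ∀ X Y : Tensor n₁ n₂ n₃, ‖X‖ ≤ R → ‖Y‖ ≤ R →
      ‖gradient (spectralSum U s) X - gradient (spectralSum U s) Y‖ ≤ K * ‖X - Y‖ := by
  obtain ⟨K, hK0, hK⟩ := exists_spectralSum_quadratic_bounds (n₁ := n₁) (n₂ := n₂) U hs hsymm hd hl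
    (3 * R + 1)
  refine ⟨2 * K, by positivity, fun X Y hX hY => ?_⟩
  rcases eq_or_ne X Y with hXY | hXY
  · simp [hXY]
  have hR : 0 ≤ R := (norm_nonneg X).trans hX
  have hX' := (hK X (by linarith)).2
  have hY' := (hK Y (by linarith)).2
  exact norm_sub_le_of_quadratic_bounds hX hY (hX' Y (by linarith)).1
    (fun z hz => (hY' z (by linarith)).1) (fun z hz => (hX' z (by linarith)).2) hK0 hXY

end SpectralSmooth

/-! ### Subdifferential calculus -/

section Calculus

variable {E : Type*} [NormedAddCommGroup E] [InnerProductSpace ℝ E]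

/-- This `ε` form and its converse below replace the liminf of extended-real quotients in the later
arguments. -/
theorem mem_regularSubdifferential_of_eventually {F : E → EReal} {x w : E} {a : ℝ} (ha : F x = a)
    (h : ∀ ε : ℝ, 0 < ε → ∀ᶠ z in 𝓝 x,
      ((a + inner ℝ w (z - x) - ε * ‖z - x‖ : ℝ) : EReal) ≤ F z) :
    w ∈ regularSubdifferential F x := by
  refine ⟨by simp [ha], by simp [ha], ?_⟩
  by_contra! hlt
  obtain ⟨c, hc, hc0⟩ := EReal.lt_iff_exists_real_btwn.1 hlt
  refine absurd hc (not_lt.2 (le_liminf_of_le (by isBoundedDefault) ?_))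
  have hc0' : 0 < -c := by
    have : c < 0 := by exact_mod_cast hc0
    linarith
  filter_upwards [nhdsWithin_le_nhds (h (-c) hc0'), self_mem_nhdsWithin] with z hz hzx
  have hn : 0 < ‖z - x‖ := norm_pos_iff.2 (sub_ne_zero.2 hzx)
  rw [ha]
  induction hFz : F z with
  | bot =>
    rw [hFz, le_bot_iff] at hz
    exact absurd hz (EReal.coe_ne_bot _)
  | top =>
    rw [EReal.top_sub_coe, EReal.top_sub_coe,
      EReal.top_div_of_pos_ne_top (by exact_mod_cast hn) (EReal.coe_ne_top _)]
    exact le_top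
  | coe b =>
    rw [hFz, EReal.coe_le_coe_iff] at hz
    rw [← EReal.coe_sub, ← EReal.coe_sub, ← EReal.coe_div, EReal.coe_le_coe_iff, le_div_iff₀ hn]
    linarith

theorem eventually_of_mem_regularSubdifferential {F : E → EReal} {x w : E}
    (hw : w ∈ regularSubdifferential F x) {a : ℝ} (ha : F x = a) {ε : ℝ} (hε : 0 < ε) :
    ∀ᶠ z in 𝓝[≠] x, ((a + inner ℝ w (z - x) - ε * ‖z - x‖ : ℝ) : EReal) ≤ F z := by
  have h1 : ((-ε : ℝ) : EReal) < liminf (fun z => (F z - F x - ((inner ℝ w (z - x) : ℝ) : EReal)) /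
      ((‖z - x‖ : ℝ) : EReal)) (𝓝[≠] x) := lt_of_lt_of_le (by simpa using hε) hw.2.2
  filter_upwards [eventually_lt_of_lt_liminf h1, self_mem_nhdsWithin] with z hz hzx
  have hn : 0 < ‖z - x‖ := norm_pos_iff.2 (sub_ne_zero.2 hzx)
  rw [ha] at hz
  induction hFz : F z with
  | bot =>
    rw [hFz, EReal.bot_sub, EReal.bot_sub, EReal.bot_div_of_pos_ne_top (by exact_mod_cast hn)
      (EReal.coe_ne_top _)] at hz
    simp at hz
  | top => exact le_top
  | coe b =>
    rw [hFz] at hz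
    rw [← EReal.coe_sub, ← EReal.coe_sub, ← EReal.coe_div, EReal.coe_lt_coe_iff, lt_div_iff₀ hn] at hz
    rw [EReal.coe_le_coe_iff]
    linarith

omit [NormedAddCommGroup E] [InnerProductSpace ℝ E] in
theorem coe_add_indicator_of_mem {D : Set E} {a : ℝ} {x : E} (hx : x ∈ D) :
    (a : EReal) + indicator D x = a := by simp [indicator, hx]

omit [NormedAddCommGroup E] [InnerProductSpace ℝ E] in
theorem coe_add_indicator_of_notMem {D : Set E} {a : ℝ} {x : E} (hx : x ∉ D) :
    (a : EReal) + indicator D x = ⊤ := by simp [indicator, hx]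

omit [NormedAddCommGroup E] [InnerProductSpace ℝ E] in
theorem coe_le_coe_add_indicator {D : Set E} {a b : ℝ} {x : E} (h : x ∈ D → b ≤ a) :
    (b : EReal) ≤ (a : EReal) + indicator D x := by
  by_cases hx : x ∈ D
  · rw [coe_add_indicator_of_mem hx]
    exact_mod_cast h hx
  · rw [coe_add_indicator_of_notMem hx]
    exact le_top

theorem regularSubdifferential_subset_subdifferential (F : E → EReal) (x : E) :
    regularSubdifferential F x ⊆ subdifferential F x := fun w hw =>
  ⟨hw.1, hw.2.1, fun _ => x, fun _ => w, tendsto_const_nhds, tendsto_const_nhds,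
    tendsto_const_nhds, fun _ => hw⟩

variable {D : Set E} {φ : E → ℝ}

/-- On the segment from `x` to `z`, convexity bounds the increment by `t` times the full one.
Dividing the local inequality by `t` makes it global, up to an arbitrary `δ`. -/
theorem regular_subgradient_inequality (hφ : ConvexOn ℝ D φ) {x w : E}
    (hw : w ∈ regularSubdifferential (fun z => (φ z : EReal) + indicator D z) x) :
    x ∈ D ∧ ∀ z ∈ D, φ x + inner ℝ w (z - x) ≤ φ z := by
  have hx : x ∈ D := by
    by_contra hx
    exact hw.2.1 (coe_add_indicator_of_notMem hx)
  refine ⟨hx, fun z hz => ?_⟩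
  rcases eq_or_ne z x with rfl | hzx
  · simp
  have hn : 0 < ‖z - x‖ := norm_pos_iff.2 (sub_ne_zero.2 hzx)
  refine le_of_forall_pos_le_add fun δ hδ => ?_
  have h1 : Tendsto (fun t : ℝ => x + t • (z - x)) (𝓝[>] 0) (𝓝[≠] x) := by
    refine tendsto_nhdsWithin_iff.2 ⟨?_, ?_⟩
    · have : Tendsto (fun t : ℝ => x + t • (z - x)) (𝓝 0) (𝓝 (x + (0 : ℝ) • (z - x))) :=
        Continuous.tendsto (by fun_prop) 0
      simpa using this.mono_left nhdsWithin_le_nhds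
    · filter_upwards [self_mem_nhdsWithin] with t ht
      have : t ≠ 0 := ne_of_gt ht
      simpa [this, sub_eq_zero] using hzx
  have h2 := h1.eventually (eventually_of_mem_regularSubdifferential hw
    (coe_add_indicator_of_mem hx) (ε := δ / ‖z - x‖) (by positivity))
  obtain ⟨t, h3, ht⟩ := (h2.and (Ioc_mem_nhdsGT (zero_lt_one' ℝ))).exists
  have hmem : x + t • (z - x) ∈ D := hφ.1.add_smul_sub_mem hx hz ⟨ht.1.le, ht.2⟩
  rw [coe_add_indicator_of_mem hmem, EReal.coe_le_coe_iff, add_sub_cancel_left, inner_smul_right,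
    norm_smul, Real.norm_of_nonneg ht.1.le] at h3
  have h4 := hφ.2 hx hz (sub_nonneg.2 ht.2) ht.1.le (sub_add_cancel 1 t)
  rw [show (1 - t) • x + t • z = x + t • (z - x) by module] at h4
  simp only [smul_eq_mul] at h4
  have h5 : δ / ‖z - x‖ * (t * ‖z - x‖) = t * δ := by field_simp
  rw [h5] at h3
  have h6 : t * (φ x + inner ℝ w (z - x)) ≤ t * (φ z + δ) := by nlinarith
  exact le_of_mul_le_mul_left h6 ht.1

/-- For convex functions, limiting subgradients are subgradients of convex analysis. -/
theorem subgradient_inequality (hφ : ConvexOn ℝ D φ) {x w : E}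
    (hw : w ∈ subdifferential (fun z => (φ z : EReal) + indicator D z) x) :
    x ∈ D ∧ ∀ z ∈ D, φ x + inner ℝ w (z - x) ≤ φ z := by
  obtain ⟨-, htop, u, v, hu, hFu, hv, huv⟩ := hw
  have hx : x ∈ D := by
    by_contra hx
    exact htop (coe_add_indicator_of_notMem hx)
  refine ⟨hx, fun z hz => ?_⟩
  -- The approximating points lie in `D`, so convergence of the extended values is convergence of `φ
  -- (u k)`; continuity of `φ` is not needed.
  have hk := fun k => regular_subgradient_inequality hφ (huv k)
  simp only [coe_add_indicator_of_mem hx, coe_add_indicator_of_mem (hk _).1,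
    EReal.tendsto_coe] at hFu
  have hlim : Tendsto (fun k => φ (u k) + inner ℝ (v k) (z - u k)) atTop
      (𝓝 (φ x + inner ℝ w (z - x))) :=
    hFu.add (hv.inner (tendsto_const_nhds.sub hu))
  exact le_of_tendsto hlim (Eventually.of_forall fun k => (hk k).2 z hz)

/-- Only `ψ - φ` has to be differentiable. This carries subgradients of the majorant over to the
objective. -/
theorem add_gradient_mem_subdifferential [CompleteSpace E] {ψ : E → ℝ} {x w g : E} (hx : x ∈ D)
    (hw : ∀ z ∈ D, φ x + inner ℝ w (z - x) ≤ φ z)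
    (hg : HasGradientAt (fun z => ψ z - φ z) g x) :
    w + g ∈ subdifferential (fun z => (ψ z : EReal) + indicator D z) x := by
  refine regularSubdifferential_subset_subdifferential _ _
    (mem_regularSubdifferential_of_eventually (coe_add_indicator_of_mem hx) fun ε hε => ?_)
  filter_upwards [(hasGradientAt_iff_isLittleO.1 hg).bound hε] with z hz
  refine coe_le_coe_add_indicator fun hzD => ?_
  have h1 := hw z hzD
  have h2 := (abs_le.1 hz).1
  rw [inner_add_left]
  linarith

end Calculus

/-! ### Rates of scalar sequences -/

theorem exists_forall_le_mul_of_eventually {u v : ℕ → ℝ} {t₀ : ℕ} (hv : ∀ t ≥ t₀, 0 < v t) {N : ℕ}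
    {w : ℝ} (h : ∀ t ≥ N, u t ≤ w * v t) : ∃ w' > (0 : ℝ), ∀ t ≥ t₀, u t ≤ w' * v t := by
  have h0 : ∀ t, 0 ≤ |u t| / |v t| := fun t => by positivity
  have hsum : 0 ≤ ∑ t ∈ Finset.range N, |u t| / |v t| := Finset.sum_nonneg fun t _ => h0 t
  refine ⟨|w| + 1 + ∑ t ∈ Finset.range N, |u t| / |v t|, by positivity, fun t ht => ?_⟩
  have hvt := hv t ht
  rcases lt_or_ge t N with htN | htN
  · have h1 := Finset.single_le_sum (f := fun t => |u t| / |v t|) (fun t _ => h0 t)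
      (Finset.mem_range.2 htN)
    have h2 : u t ≤ |u t| / |v t| * v t := by
      rw [abs_of_pos hvt, div_mul_cancel₀ _ hvt.ne']
      exact le_abs_self _
    refine h2.trans (mul_le_mul_of_nonneg_right ?_ hvt.le)
    linarith [abs_nonneg w]
  · refine (h t htN).trans (mul_le_mul_of_nonneg_right ?_ hvt.le)
    linarith [le_abs_self w]

theorem one_add_inv_rpow_le {q τ : ℝ} (hq : 0 ≤ q) (hτ : 1 ≤ τ) :
    (1 + τ⁻¹) ^ q ≤ 1 + 2 * q * Real.exp q / (τ + 1) := by
  have hτ0 : 0 < τ := by linarith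
  set y := q / τ with hy
  have hy0 : 0 ≤ y := by positivity
  have hyq : y ≤ q := div_le_self hq hτ
  have h1 : (1 + τ⁻¹) ^ q ≤ Real.exp y := by
    have := Real.rpow_le_rpow (by positivity) (by linarith [Real.add_one_le_exp τ⁻¹] :
      1 + τ⁻¹ ≤ Real.exp τ⁻¹) hq
    rwa [← Real.exp_mul, show τ⁻¹ * q = y by rw [hy]; field_simp] at this
  have h2 : Real.exp y ≤ 1 + y * Real.exp y := by
    have h3 := mul_le_mul_of_nonneg_left (Real.add_one_le_exp (-y)) (Real.exp_pos y).le
    rw [← Real.exp_add, add_neg_cancel, Real.exp_zero] at h3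
    linarith
  have h3 : y * Real.exp y ≤ 2 * q * Real.exp q / (τ + 1) := by
    calc y * Real.exp y ≤ q / τ * Real.exp q := by gcongr
      _ ≤ 2 * q * Real.exp q / (τ + 1) := by
        rw [div_mul_eq_mul_div, div_le_div_iff₀ hτ0 (by positivity)]
        nlinarith [mul_nonneg hq (Real.exp_pos q).le]
  linarith

/-- Sublinear decay of a sequence with `h (n + 1) + κ * h (n + 1) ^ ν ≤ h n`. -/
theorem exists_le_mul_rpow_of_recursion {h : ℕ → ℝ} {κ ν : ℝ} (hκ : 0 < κ) (hν : 1 < ν)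
    (hpos : ∀ n, 0 < h n) (hrec : ∀ n, h (n + 1) + κ * h (n + 1) ^ ν ≤ h n) :
    ∃ W > (0 : ℝ), ∀ n : ℕ, h n ≤ W * ((n : ℝ) + 1) ^ (-(1 / (ν - 1))) := by
  set q := 1 / (ν - 1) with hqdef
  have hν1 : 0 < ν - 1 := by linarith
  have hq : 0 < q := by positivity
  have hqν : q * (ν - 1) = 1 := by rw [hqdef]; field_simp
  set B := 2 * q * Real.exp q with hB
  have hB0 : 0 < B := by positivity
  -- The first entry starts the induction. The second gives `B ≤ κ * W ^ (ν - 1)`, so the decrease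
  -- beats the change of `τ ^ (-q)` from `τ` to `τ + 1`.
  set W := max (h 0) ((B / κ) ^ q) with hW
  have hW0 : 0 < W := (hpos 0).trans_le (le_max_left _ _)
  have hWB : B ≤ κ * W ^ (ν - 1) := by
    have h1 : ((B / κ) ^ q) ^ (ν - 1) ≤ W ^ (ν - 1) :=
      Real.rpow_le_rpow (by positivity) (le_max_right _ _) hν1.le
    rw [← Real.rpow_mul (by positivity), hqν, Real.rpow_one, div_le_iff₀ hκ] at h1
    linarith
  refine ⟨W, hW0, fun n => ?_⟩
  induction n with
  | zero =>
    rw [Nat.cast_zero, zero_add, Real.one_rpow, mul_one]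
    exact le_max_left _ _
  | succ n ih =>
    by_contra! hlt
    push_cast at hlt
    set τ : ℝ := (n : ℝ) + 1 with hτ
    have hτ1 : 1 ≤ τ := by
      have : (0 : ℝ) ≤ n := n.cast_nonneg
      linarith
    have hτ0 : 0 < τ := by linarith
    set y := W * (τ + 1) ^ (-q) with hy
    have hy0 : 0 < y := by positivity
    -- If `h (n + 1)` exceeded its bound `y`, monotonicity of `y + κ * y ^ ν` would push `h n` above
    -- its own bound.
    have h1 : y + κ * y ^ ν < h n := by
      refine lt_of_lt_of_le ?_ (hrec n)
      have : y ^ ν ≤ h (n + 1) ^ ν := Real.rpow_le_rpow hy0.le hlt.le (by linarith)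
      nlinarith
    have h2 : y ^ ν = y * (W ^ (ν - 1) / (τ + 1)) := by
      have h3 : y ^ (ν - 1) = W ^ (ν - 1) / (τ + 1) := by
        rw [hy, Real.mul_rpow hW0.le (by positivity), ← Real.rpow_mul (by positivity), neg_mul, hqν,
          Real.rpow_neg_one, div_eq_mul_inv]
      rw [← h3, Real.rpow_sub_one hy0.ne']
      field_simp
    have h4 : W * τ ^ (-q) = y * (1 + τ⁻¹) ^ q := by
      have : 1 + τ⁻¹ = (τ + 1) / τ := by field_simp
      rw [hy, this, Real.div_rpow (by positivity) hτ0.le, Real.rpow_neg hτ0.le,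
        Real.rpow_neg (by positivity : 0 ≤ τ + 1)]
      have : (τ + 1) ^ q ≠ 0 := (by positivity : 0 < (τ + 1) ^ q).ne'
      field_simp
    have h5 := one_add_inv_rpow_le hq.le hτ1
    rw [h4] at ih
    have h6 : B / (τ + 1) ≤ κ * W ^ (ν - 1) / (τ + 1) := by gcongr
    have h7 : y * (1 + τ⁻¹) ^ q ≤ y * (1 + κ * W ^ (ν - 1) / (τ + 1)) :=
      mul_le_mul_of_nonneg_left (by linarith) hy0.le
    have h8 : y * (1 + κ * W ^ (ν - 1) / (τ + 1)) = y + κ * y ^ ν := by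
      rw [h2]
      ring
    linarith

theorem exists_le_mul_pow_of_recursion {h : ℕ → ℝ} {κ : ℝ} (hκ : 0 < κ)
    (hrec : ∀ n, h (n + 1) + κ * h (n + 1) ≤ h n) (n : ℕ) : h n ≤ h 0 * (1 / (1 + κ)) ^ n := by
  induction n with
  | zero => simp
  | succ n ih =>
    have h1 : h (n + 1) ≤ h n * (1 / (1 + κ)) := by
      rw [mul_one_div, le_div_iff₀ (by linarith)]
      linarith [hrec n]
    rw [pow_succ, ← mul_assoc]
    exact h1.trans (mul_le_mul_of_nonneg_right ih (by positivity))

/-- The tangent inequality for the concave power `p`, obtained from Bernoulli's inequality at `v /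
u`. -/
theorem mul_rpow_neg_mul_sub_le {u v p : ℝ} (hu : 0 < u) (hv : 0 ≤ v) (hp : 0 ≤ p) (hp1 : p ≤ 1) :
    p * (u - v) ≤ u ^ (1 - p) * (u ^ p - v ^ p) := by
  have h1 := rpow_one_add_le_one_add_mul_self (s := v / u - 1)
    (by linarith [div_nonneg hv hu.le]) hp hp1
  rw [add_sub_cancel, Real.div_rpow hv hu.le, div_le_iff₀ (by positivity)] at h1
  have h2 : u ^ (1 - p) * u ^ p = u := by rw [← Real.rpow_add hu]; simp
  have h3 : u ^ (1 - p) * v ^ p ≤ u ^ (1 - p) * ((1 + p * (v / u - 1)) * u ^ p) := by gcongr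
  have h4 : u ^ (1 - p) * ((1 + p * (v / u - 1)) * u ^ p) = u + p * (v - u) := by
    rw [mul_comm (1 + _), ← mul_assoc, h2]
    field_simp
  linarith

/-! ### Descent sequences with the KL property -/

section Descent

variable {E : Type*} [NormedAddCommGroup E] {X : ℕ → E} {h : ℕ → ℝ} {x : E} {a C α r η : ℝ}

/-- A sequence with sufficient decrease of the gap `h` to a limiting value, such that, near `x`, the
gap raised to the power `α` is at most a multiple of the last step. -/
structure IsKLDescent (X : ℕ → E) (h : ℕ → ℝ) (x : E) (a C α r η : ℝ) : Prop where
  a_pos : 0 < a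
  C_pos : 0 < C
  r_pos : 0 < r
  eta_pos : 0 < η
  exponent_nonneg : 0 ≤ α
  exponent_lt : α < 1
  nonneg : ∀ t, 0 ≤ h t
  decrease : ∀ t, h (t + 1) + a * ‖X (t + 1) - X t‖ ^ 2 ≤ h t
  tendsto : Tendsto h atTop (𝓝 0)
  cluster : MapClusterPt x atTop X
  kl : ∀ t, ‖X (t + 1) - x‖ < r → 0 < h (t + 1) → h (t + 1) < η →
    h (t + 1) ^ α ≤ C * ‖X (t + 1) - X t‖

namespace IsKLDescent

theorem antitone (H : IsKLDescent X h x a C α r η) : Antitone h :=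
  antitone_nat_of_succ_le fun t => by
    nlinarith [H.decrease t, mul_nonneg H.a_pos.le (sq_nonneg ‖X (t + 1) - X t‖)]

theorem step_le (H : IsKLDescent X h x a C α r η) (t : ℕ) :
    ‖X (t + 1) - X t‖ ≤ √(1 / a) * √(h t) := by
  rw [← Real.sqrt_mul (by have := H.a_pos; positivity)]
  refine Real.le_sqrt_of_sq_le ?_
  rw [one_div_mul_eq_div, le_div_iff₀ H.a_pos]
  linarith [H.decrease t, H.nonneg (t + 1)]

theorem tendsto_step (H : IsKLDescent X h x a C α r η) :
    Tendsto (fun t => ‖X (t + 1) - X t‖) atTop (𝓝 0) := by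
  have h1 : Tendsto (fun t => √(1 / a) * √(h t)) atTop (𝓝 (√(1 / a) * √0)) :=
    ((Real.continuous_sqrt.tendsto 0).comp H.tendsto).const_mul _
  rw [Real.sqrt_zero, mul_zero] at h1
  exact squeeze_zero (fun t => norm_nonneg _) H.step_le h1

/-- The sequence is eventually constant once the gap vanishes. -/
theorem eq_of_gap_eq_zero (H : IsKLDescent X h x a C α r η) {T : ℕ} (hT : h T = 0) :
    ∀ t ≥ T, X t = x := by
  have h0 : ∀ t ≥ T, h t = 0 := fun t ht => le_antisymm (hT ▸ H.antitone ht) (H.nonneg t)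
  have h1 : ∀ t ≥ T, X t = X T := by
    intro t ht
    induction t, ht using Nat.le_induction with
    | base => rfl
    | succ t ht ih =>
      have h2 := H.step_le t
      rw [h0 t ht, Real.sqrt_zero, mul_zero] at h2
      rw [← ih]
      exact sub_eq_zero.1 (norm_le_zero_iff.1 h2)
  have h2 : Tendsto X atTop (𝓝 (X T)) :=
    tendsto_const_nhds.congr' (eventually_atTop.2 ⟨T, fun t ht => (h1 t ht).symm⟩)
  have h3 : x = X T := by
    have : ClusterPt x (𝓝 (X T)) := ClusterPt.mono H.cluster h2
    exact eq_of_nhds_neBot this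
  exact fun t ht => (h1 t ht).trans h3.symm

/-- The factor of the desingularized gap in the bound of the steps. -/
def factor (a C α : ℝ) : ℝ := C / ((1 - α) * a)

theorem factor_nonneg (H : IsKLDescent X h x a C α r η) : 0 ≤ factor a C α := by
  have h1 := H.a_pos
  have h2 := H.C_pos
  have h3 : 0 < 1 - α := by linarith [H.exponent_lt]
  rw [factor]
  positivity

/-- Decrease, concavity and KL bound the squared step by the previous step times a telescoping
difference; the AM-GM inequality splits the product. -/
theorem two_mul_step_le (H : IsKLDescent X h x a C α r η) (hpos : ∀ t, 0 < h t) {t : ℕ}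
    (hr : ‖X (t + 1) - x‖ < r) (hη : h (t + 1) < η) :
    2 * ‖X (t + 2) - X (t + 1)‖ ≤ ‖X (t + 1) - X t‖ +
      factor a C α * (h (t + 1) ^ (1 - α) - h (t + 2) ^ (1 - α)) := by
  have hp : 0 < 1 - α := by linarith [H.exponent_lt]
  have ha := H.a_pos
  have h1 := H.kl t hr (hpos _) hη
  have h2 := mul_rpow_neg_mul_sub_le (hpos (t + 1)) (hpos (t + 2)).le hp.le
    (by linarith [H.exponent_nonneg])
  rw [sub_sub_cancel] at h2
  have h3 := H.decrease (t + 1)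
  set d := ‖X (t + 1 + 1) - X (t + 1)‖
  set d' := ‖X (t + 1) - X t‖
  set Δ := h (t + 1) ^ (1 - α) - h (t + 2) ^ (1 - α) with hΔ
  have hΔ0 : 0 ≤ Δ := sub_nonneg.2
    (Real.rpow_le_rpow (hpos _).le (H.antitone (Nat.le_succ _)) hp.le)
  have h4 : (1 - α) * (a * d ^ 2) ≤ C * d' * Δ :=
    calc (1 - α) * (a * d ^ 2) ≤ (1 - α) * (h (t + 1) - h (t + 2)) := by
          gcongr
          linarith
      _ ≤ h (t + 1) ^ α * Δ := h2
      _ ≤ C * d' * Δ := by gcongr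
  have h5 : d ^ 2 ≤ d' * (factor a C α * Δ) := by
    have : d' * (factor a C α * Δ) = C * d' * Δ / ((1 - α) * a) := by
      rw [factor]
      ring
    rw [this, le_div_iff₀ (by positivity)]
    linarith
  have h6 : 0 ≤ factor a C α * Δ := mul_nonneg H.factor_nonneg hΔ0
  have hd' : 0 ≤ d' := norm_nonneg _
  refine le_of_sq_le_sq ?_ (add_nonneg hd' h6)
  nlinarith [sq_nonneg (d' - factor a C α * Δ)]

/-- The distance to a point plus the remaining length does not increase. -/
theorem potential_succ_le (H : IsKLDescent X h x a C α r η) (hpos : ∀ t, 0 < h t) (z : E) {t : ℕ}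
    (hr : ‖X (t + 1) - x‖ < r) (hη : h (t + 1) < η) :
    ‖X (t + 2) - z‖ + ‖X (t + 2) - X (t + 1)‖ + factor a C α * h (t + 2) ^ (1 - α) ≤
      ‖X (t + 1) - z‖ + ‖X (t + 1) - X t‖ + factor a C α * h (t + 1) ^ (1 - α) := by
  have h1 := H.two_mul_step_le hpos hr hη
  have h2 := norm_sub_le_norm_sub_add_norm_sub (X (t + 2)) (X (t + 1)) z
  linarith

theorem tendsto_rpow_gap (H : IsKLDescent X h x a C α r η) :
    Tendsto (fun t => h t ^ (1 - α)) atTop (𝓝 0) := by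
  have hp : 0 < 1 - α := by linarith [H.exponent_lt]
  have := H.tendsto.rpow_const (Or.inr hp.le)
  rwa [Real.zero_rpow hp.ne'] at this

/-- A descent sequence with the KL property converges, and the distance to the limit is bounded by
the last step and the desingularized gap. -/
theorem exists_forall_norm_sub_le (H : IsKLDescent X h x a C α r η) (hpos : ∀ t, 0 < h t) :
    Tendsto X atTop (𝓝 x) ∧ ∃ T, ∀ t ≥ T, ‖X (t + 1) - x‖ < r ∧ h (t + 1) < η ∧
      ‖X (t + 1) - x‖ ≤ ‖X (t + 1) - X t‖ + factor a C α * h (t + 1) ^ (1 - α) := by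
  have hM := H.factor_nonneg
  set Φ : E → ℕ → ℝ := fun z t =>
    ‖X (t + 1) - z‖ + ‖X (t + 1) - X t‖ + factor a C α * h (t + 1) ^ (1 - α) with hΦ
  have hle : ∀ z t, ‖X (t + 1) - z‖ ≤ Φ z t := by
    intro z t
    have := mul_nonneg hM (Real.rpow_nonneg (H.nonneg (t + 1)) (1 - α))
    simp only [hΦ]
    linarith [norm_nonneg (X (t + 1) - X t)]
  obtain ⟨T₀, hT₀⟩ := eventually_atTop.1 (H.tendsto.eventually (gt_mem_nhds H.eta_pos))
  have hη : ∀ t ≥ T₀, h (t + 1) < η := fun t ht => hT₀ _ (by omega)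
  have hsmall : ∀ ε > 0, ∃ T ≥ T₀, Φ x T < ε := by
    intro ε hε
    have h1 : Tendsto (fun t => 2 * ‖X (t + 1) - X t‖ + factor a C α * h (t + 1) ^ (1 - α)) atTop
        (𝓝 (2 * 0 + factor a C α * 0)) :=
      (H.tendsto_step.const_mul _).add
        ((H.tendsto_rpow_gap.comp (tendsto_add_atTop_nat 1)).const_mul _)
    rw [mul_zero, mul_zero, add_zero] at h1
    obtain ⟨t, h2, h3, h4⟩ := ((mapClusterPt_iff_frequently.1 H.cluster _
      (Metric.ball_mem_nhds x (half_pos hε))).and_eventually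
        ((h1.eventually (gt_mem_nhds (half_pos hε))).and (eventually_ge_atTop T₀))).exists
    rw [Metric.mem_ball, dist_eq_norm] at h2
    refine ⟨t, h4, ?_⟩
    have h5 := norm_sub_le_norm_sub_add_norm_sub (X (t + 1)) (X t) x
    simp only [hΦ]
    linarith
  -- A potential below `r` keeps the iterate in the ball where KL holds, which in turn keeps the
  -- potential from growing.
  have htrap : ∀ T ≥ T₀, Φ x T < r → ∀ t ≥ T, Φ x t ≤ Φ x T := by
    intro T hT hTr t ht
    induction t, ht using Nat.le_induction with
    | base => exact le_rfl
    | succ t ht ih =>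
      exact (H.potential_succ_le hpos x ((hle x t).trans_lt (ih.trans_lt hTr))
        (hη t (hT.trans ht))).trans ih
  have hlim : Tendsto X atTop (𝓝 x) := by
    rw [← tendsto_add_atTop_iff_nat 1, Metric.tendsto_atTop]
    intro ε hε
    obtain ⟨T, hT, hTε⟩ := hsmall (min ε r) (lt_min hε H.r_pos)
    refine ⟨T, fun t ht => ?_⟩
    rw [dist_eq_norm]
    exact (hle x t).trans_lt ((htrap T hT (hTε.trans_le (min_le_right _ _)) t ht).trans_lt
      (hTε.trans_le (min_le_left _ _)))
  refine ⟨hlim, ?_⟩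
  obtain ⟨T, hT, hTr⟩ := hsmall r H.r_pos
  have hr : ∀ t ≥ T, ‖X (t + 1) - x‖ < r := fun t ht =>
    (hle x t).trans_lt ((htrap T hT hTr t ht).trans_lt hTr)
  refine ⟨T, fun t ht => ⟨hr t ht, hη t (hT.trans ht), ?_⟩⟩
  -- Recentred at `X (t + 1)`, the potential at time `t` has no distance term. Letting `k` tend to
  -- infinity bounds the distance to the limit.
  have hmono : ∀ k ≥ t, Φ (X (t + 1)) k ≤ Φ (X (t + 1)) t := by
    intro k hk
    induction k, hk using Nat.le_induction with
    | base => exact le_rfl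
    | succ k hk ih =>
      exact (H.potential_succ_le hpos _ (hr k (ht.trans hk)) (hη k (hT.trans (ht.trans hk)))).trans ih
  have h1 : Tendsto (fun k => ‖X (k + 1) - X (t + 1)‖) atTop (𝓝 ‖x - X (t + 1)‖) :=
    ((hlim.comp (tendsto_add_atTop_nat 1)).sub_const _).norm
  have h2 := le_of_tendsto h1 (eventually_atTop.2 ⟨t, fun k hk => (hle _ k).trans (hmono k hk)⟩)
  rw [norm_sub_rev]
  simpa [hΦ] using h2

/-- Recursion of the gap and bound of the distance to the limit by a power of the gap. -/
theorem exists_recursion (H : IsKLDescent X h x a C α r η) (hpos : ∀ t, 0 < h t) :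
    ∃ T, ∃ κ > 0, ∃ M > 0, ∀ t ≥ T, h t ≤ 1 ∧ h (t + 1) + κ * h (t + 1) ^ (2 * α) ≤ h t ∧
      ‖X (t + 1) - x‖ ≤ M * (h t ^ (1 / 2 : ℝ) + h t ^ (1 - α)) := by
  have ha := H.a_pos
  have hC := H.C_pos
  have hM := H.factor_nonneg
  obtain ⟨-, T, hT⟩ := H.exists_forall_norm_sub_le hpos
  obtain ⟨T₁, hT₁⟩ := eventually_atTop.1 (H.tendsto.eventually (ge_mem_nhds zero_lt_one))
  -- `a / C ^ 2` comes from inserting the squared KL bound into the decrease.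
  refine ⟨max T T₁, a / C ^ 2, by positivity, √(1 / a) + factor a C α, by positivity,
    fun t ht => ⟨hT₁ t ((le_max_right _ _).trans ht), ?_, ?_⟩⟩
  · obtain ⟨h1, h2, -⟩ := hT t ((le_max_left _ _).trans ht)
    have h3 := H.kl t h1 (hpos _) h2
    have h4 : h (t + 1) ^ (2 * α) ≤ (C * ‖X (t + 1) - X t‖) ^ 2 := by
      rw [mul_comm 2 α, Real.rpow_mul (hpos _).le, Real.rpow_two]
      exact pow_le_pow_left₀ (Real.rpow_nonneg (hpos _).le _) h3 2
    have h5 : a / C ^ 2 * h (t + 1) ^ (2 * α) ≤ a * ‖X (t + 1) - X t‖ ^ 2 := by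
      calc a / C ^ 2 * h (t + 1) ^ (2 * α) ≤ a / C ^ 2 * (C * ‖X (t + 1) - X t‖) ^ 2 := by gcongr
        _ = _ := by field_simp
    linarith [H.decrease t]
  · obtain ⟨-, -, h1⟩ := hT t ((le_max_left _ _).trans ht)
    have h2 := H.step_le t
    rw [Real.sqrt_eq_rpow (h t)] at h2
    have h3 : h (t + 1) ^ (1 - α) ≤ h t ^ (1 - α) :=
      Real.rpow_le_rpow (hpos _).le (H.antitone (Nat.le_succ _)) (by linarith [H.exponent_lt])
    have h4 := mul_le_mul_of_nonneg_left h3 hM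
    have h5 : 0 ≤ factor a C α * h t ^ (1 / 2 : ℝ) :=
      mul_nonneg hM (Real.rpow_nonneg (hpos t).le _)
    have h6 : 0 ≤ √(1 / a) * h t ^ (1 - α) :=
      mul_nonneg (Real.sqrt_nonneg _) (Real.rpow_nonneg (hpos t).le _)
    nlinarith

theorem tendsto_of_descent (H : IsKLDescent X h x a C α r η) : Tendsto X atTop (𝓝 x) := by
  by_cases hpos : ∀ t, 0 < h t
  · exact (H.exists_forall_norm_sub_le hpos).1
  · push Not at hpos
    obtain ⟨T, hT⟩ := hpos
    have := H.eq_of_gap_eq_zero (le_antisymm hT (H.nonneg T))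
    exact tendsto_const_nhds.congr' (eventually_atTop.2 ⟨T, fun t ht => (this t ht).symm⟩)

/-- For exponent zero, KL bounds the steps below by `1 / C` as long as the gap is positive, although
they tend to zero. -/
theorem finite_termination (H : IsKLDescent X h x a C α r η) (hα : α = 0) :
    ∃ T : ℕ, ∀ t ≥ T, X t = x := by
  by_cases hpos : ∀ t, 0 < h t
  · exfalso
    obtain ⟨-, T, hT⟩ := H.exists_forall_norm_sub_le hpos
    have h1 := H.tendsto_step.const_mul C
    rw [mul_zero] at h1
    obtain ⟨t, h2, h3⟩ := ((h1.eventually (gt_mem_nhds zero_lt_one)).and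
      (eventually_ge_atTop T)).exists
    have h4 := H.kl t (hT t h3).1 (hpos _) (hT t h3).2.1
    rw [hα, Real.rpow_zero] at h4
    linarith
  · push Not at hpos
    obtain ⟨T, hT⟩ := hpos
    exact ⟨T, H.eq_of_gap_eq_zero (le_antisymm hT (H.nonneg T))⟩

/-- For gaps at most one, `h ^ (2 * α)` dominates `h`, so the gap decays geometrically. The distance
is then controlled by `√h`, hence the square root in `θ`. -/
theorem linear_rate (H : IsKLDescent X h x a C α r η) (hα : α ≤ 1 / 2) :
    ∃ w > (0 : ℝ), ∃ θ : ℝ, 0 < θ ∧ θ < 1 ∧ ∀ t : ℕ, ‖X t - x‖ ≤ w * θ ^ t := by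
  by_cases hpos : ∀ t, 0 < h t
  · obtain ⟨T, κ, hκ, M, hM, hT⟩ := H.exists_recursion hpos
    have hrec := exists_le_mul_pow_of_recursion (h := fun n => h (T + n)) hκ fun n => by
      obtain ⟨-, h2, -⟩ := hT (T + n) (by omega)
      have h3 : h (T + n + 1) ^ (1 : ℝ) ≤ h (T + n + 1) ^ (2 * α) :=
        Real.rpow_le_rpow_of_exponent_ge (hpos _) (hT (T + n + 1) (by omega)).1 (by linarith)
      rw [Real.rpow_one] at h3
      have := mul_le_mul_of_nonneg_left h3 hκ.le
      change h (T + n + 1) + κ * h (T + n + 1) ≤ h (T + n)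
      linarith
    set θ := √(1 / (1 + κ)) with hθ
    have hθ0 : 0 < θ := Real.sqrt_pos.2 (by positivity)
    have hθ1 : θ < 1 := by
      rw [hθ, Real.sqrt_lt' one_pos, one_pow, div_lt_one (by linarith)]
      linarith
    have key : ∀ t ≥ T + 1, ‖X t - x‖ ≤ 2 * M * √(h T) / θ ^ (T + 1) * θ ^ t := by
      intro t ht
      obtain ⟨n, rfl⟩ := Nat.exists_eq_add_of_le ht
      obtain ⟨h1, -, h3⟩ := hT (T + n) (by omega)
      have h4 : h (T + n) ^ (1 - α) ≤ h (T + n) ^ (1 / 2 : ℝ) :=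
        Real.rpow_le_rpow_of_exponent_ge (hpos _) h1 (by linarith)
      have h5 : √(h (T + n)) ≤ √(h T) * θ ^ n := by
        refine Real.sqrt_le_iff.2 ⟨by positivity, ?_⟩
        rw [mul_pow, Real.sq_sqrt (hpos _).le, ← pow_mul, mul_comm n 2, pow_mul, hθ,
          Real.sq_sqrt (by positivity)]
        exact hrec n
      rw [← Real.sqrt_eq_rpow] at h3 h4
      rw [show T + 1 + n = T + n + 1 by ring, show θ ^ (T + n + 1) = θ ^ (T + 1) * θ ^ n by ring]
      calc ‖X (T + n + 1) - x‖ ≤ M * (√(h (T + n)) + h (T + n) ^ (1 - α)) := h3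
        _ ≤ M * (√(h T) * θ ^ n + √(h T) * θ ^ n) := by
          gcongr
          exact h4.trans h5
        _ = _ := by
          field_simp
          ring
    obtain ⟨w, hw, hw'⟩ := exists_forall_le_mul_of_eventually (t₀ := 0) (v := fun t => θ ^ t)
      (fun t _ => by positivity) key
    exact ⟨w, hw, θ, hθ0, hθ1, fun t => hw' t (Nat.zero_le t)⟩
  · push Not at hpos
    obtain ⟨T, hT⟩ := hpos
    have hc := H.eq_of_gap_eq_zero (le_antisymm hT (H.nonneg T))
    obtain ⟨w, hw, hw'⟩ := exists_forall_le_mul_of_eventually (t₀ := 0) (N := T) (w := 1)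
      (v := fun t => (1 / 2 : ℝ) ^ t) (u := fun t => ‖X t - x‖) (fun t _ => by positivity)
      (fun t ht => by
        rw [hc t ht, sub_self, norm_zero]
        positivity)
    exact ⟨w, hw, 1 / 2, by norm_num, by norm_num, fun t => hw' t (Nat.zero_le t)⟩

/-- The recursion with `ν = 2 * α` gives decay of order `-1 / (2 * α - 1)`. Now `h ^ (1 - α)`
dominates `√h`, which multiplies this order by `1 - α`. -/
theorem sublinear_rate (H : IsKLDescent X h x a C α r η) (hα : 1 / 2 < α) :
    ∃ w > (0 : ℝ), ∀ t : ℕ, 1 ≤ t →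
      ‖X t - x‖ ≤ w * (t : ℝ) ^ (-((1 - α) / (2 * α - 1))) := by
  have hα1 := H.exponent_lt
  set e := (1 - α) / (2 * α - 1) with he
  have hα2 : 0 < 2 * α - 1 := by linarith
  have he0 : 0 ≤ e := div_nonneg (by linarith) hα2.le
  have hv : ∀ t ≥ 1, (0 : ℝ) < (fun t : ℕ => (t : ℝ) ^ (-e)) t := fun t ht =>
    Real.rpow_pos_of_pos (by exact_mod_cast ht) _
  by_cases hpos : ∀ t, 0 < h t
  · obtain ⟨T, κ, hκ, M, hM, hT⟩ := H.exists_recursion hpos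
    obtain ⟨W, hW, hWn⟩ := exists_le_mul_rpow_of_recursion (h := fun n => h (T + n)) (ν := 2 * α) hκ
      (by linarith) (fun n => hpos _) fun n => (hT (T + n) (by omega)).2.1
    have key : ∀ t ≥ T + 1, ‖X t - x‖ ≤
        2 * M * W ^ (1 - α) * ((T : ℝ) + 1) ^ e * (t : ℝ) ^ (-e) := by
      intro t ht
      obtain ⟨n, rfl⟩ := Nat.exists_eq_add_of_le ht
      obtain ⟨h1, -, h3⟩ := hT (T + n) (by omega)
      have h4 : h (T + n) ^ (1 / 2 : ℝ) ≤ h (T + n) ^ (1 - α) :=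
        Real.rpow_le_rpow_of_exponent_ge (hpos _) h1 (by linarith)
      have hn0 : (0 : ℝ) ≤ n := n.cast_nonneg
      have hT0 : (0 : ℝ) ≤ T := T.cast_nonneg
      have h5 : h (T + n) ^ (1 - α) ≤ W ^ (1 - α) * ((n : ℝ) + 1) ^ (-e) := by
        have h6 := Real.rpow_le_rpow (hpos _).le (hWn n) (by linarith : 0 ≤ 1 - α)
        rw [Real.mul_rpow hW.le (by positivity), ← Real.rpow_mul (by positivity)] at h6
        rwa [show -(1 / (2 * α - 1)) * (1 - α) = -e by rw [he]; ring] at h6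
      have h7 : ((n : ℝ) + 1) ^ (-e) ≤ ((T : ℝ) + 1) ^ e * ((T + 1 + n : ℕ) : ℝ) ^ (-e) := by
        have h8 : ((T + 1 + n : ℕ) : ℝ) / (T + 1) ≤ n + 1 := by
          rw [div_le_iff₀ (by positivity)]
          push_cast
          nlinarith
        have h9 := Real.rpow_le_rpow_of_nonpos (z := -e) (by positivity) h8 (by linarith)
        rw [Real.div_rpow (by positivity) (by positivity), Real.rpow_neg (by positivity : (0 : ℝ) ≤ T + 1),
          div_inv_eq_mul] at h9
        linarith
      rw [show T + 1 + n = T + n + 1 by ring] at h7 ⊢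
      calc ‖X (T + n + 1) - x‖ ≤ M * (h (T + n) ^ (1 / 2 : ℝ) + h (T + n) ^ (1 - α)) := h3
        _ ≤ M * (2 * (W ^ (1 - α) * (((T : ℝ) + 1) ^ e * ((T + n + 1 : ℕ) : ℝ) ^ (-e)))) := by
          gcongr
          have := mul_le_mul_of_nonneg_left h7 (Real.rpow_nonneg hW.le (1 - α))
          linarith
        _ = _ := by ring
    exact exists_forall_le_mul_of_eventually hv key
  · push Not at hpos
    obtain ⟨T, hT⟩ := hpos
    have hc := H.eq_of_gap_eq_zero (le_antisymm hT (H.nonneg T))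
    exact exists_forall_le_mul_of_eventually (N := T) (w := 1) hv fun t ht => by
      rw [hc t ht, sub_self, norm_zero]
      positivity

end IsKLDescent

end Descent

/-! ### The box -/

section Box

variable {n₁ n₂ n₃ : ℕ} {c : ℝ}

theorem convex_box : Convex ℝ (box n₁ n₂ n₃ c) := by
  have : box n₁ n₂ n₃ c =
      (WithLp.linearEquiv 2 ℝ (Fin n₁ × Fin n₂ × Fin n₃ → ℝ)).toLinearMap ⁻¹' Metric.closedBall 0 c := by
    ext X
    simp [box]
  rw [this]
  exact (convex_closedBall 0 c).linear_preimage _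

theorem isClosed_box : IsClosed (box n₁ n₂ n₃ c) :=
  isClosed_le (PiLp.continuous_ofLp 2 _).norm continuous_const

theorem norm_le_of_mem_box {X : Tensor n₁ n₂ n₃} (hX : X ∈ box n₁ n₂ n₃ c) :
    ‖X‖ ≤ √(Fintype.card (Fin n₁ × Fin n₂ × Fin n₃) * c ^ 2) := by
  refine Real.le_sqrt_of_sq_le ?_
  rw [EuclideanSpace.norm_sq_eq, ← nsmul_eq_mul]
  refine Finset.sum_le_card_nsmul _ _ _ fun i _ => ?_
  exact pow_le_pow_left₀ (norm_nonneg _) ((norm_le_pi_norm (WithLp.ofLp X) i).trans hX) 2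

end Box

/-! ### The majorization-minimization step -/

section Step

variable {n₁ n₂ n₃ : ℕ} (U : Matrix.unitaryGroup (Fin n₃) ℂ) {f : Tensor n₁ n₂ n₃ → ℝ}
  {g s₁ s₂ : ℝ → ℝ} {lam β c ρ : ℝ}

theorem IsDCDecomposition.symm_fst (hg : IsRegularizer lam g) (hs : IsDCDecomposition g s₁ s₂)
    (x : ℝ) : s₁ (-x) = s₁ x := by
  have h1 := hs.eq_sub x
  have h2 := hs.eq_sub (-x)
  rw [hg.symm, hs.symm_snd] at h2
  linarith

theorem IsDCDecomposition.spectralSum_eq_sub (hs : IsDCDecomposition g s₁ s₂)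
    (X : Tensor n₁ n₂ n₃) : spectralSum U g X = spectralSum U s₁ X - spectralSum U s₂ X := by
  rw [← spectralSum_sub, ← funext hs.eq_sub]

/-- The finite part of the majorant. -/
def majorantReal (f : Tensor n₁ n₂ n₃ → ℝ) (s₁ s₂ : ℝ → ℝ) (β ρ : ℝ) (Y X : Tensor n₁ n₂ n₃) : ℝ :=
  f Y + inner ℝ (gradient f Y) (X - Y) + ρ / 2 * ‖X - Y‖ ^ 2
    + β * spectralSum U s₁ X - β * spectralSum U s₂ Y
    - β * inner ℝ (gradient (spectralSum U s₂) Y) (X - Y)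

theorem convexOn_majorantReal (hβ : 0 ≤ β) (hρ : 0 ≤ ρ) (hs₁ : ConvexOn ℝ univ s₁)
    (hsymm : ∀ x, s₁ (-x) = s₁ x) (Y : Tensor n₁ n₂ n₃) :
    ConvexOn ℝ (box n₁ n₂ n₃ c) (majorantReal U f s₁ s₂ β ρ Y) := by
  set v := gradient f Y - β • gradient (spectralSum U s₂) Y with hv
  have h1 : ConvexOn ℝ univ fun X : Tensor n₁ n₂ n₃ => β • spectralSum U s₁ X :=
    (convexOn_spectralSum U hs₁ hsymm).smul hβ
  have h2 : ConvexOn ℝ univ fun X : Tensor n₁ n₂ n₃ => (ρ / 2) • dist X Y ^ 2 :=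
    ((convexOn_univ_dist Y).pow (fun _ _ => dist_nonneg) 2).smul (by linarith)
  have h3 : ConvexOn ℝ univ fun X : Tensor n₁ n₂ n₃ => inner ℝ v X :=
    (innerSL ℝ v).toLinearMap.convexOn convex_univ
  have h4 := ((h1.add h2).add h3).add_const
    (f Y - β * spectralSum U s₂ Y - inner ℝ v Y)
  refine (h4.subset (subset_univ _) convex_box).congr fun X _ => ?_
  simp only [Pi.add_apply, majorantReal, smul_eq_mul, dist_eq_norm, hv, inner_sub_left,
    inner_smul_left, inner_sub_right, conj_trivial]
  ring

theorem hasGradientAt_norm_sub_sq (Y X : Tensor n₁ n₂ n₃) :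
    HasGradientAt (fun Z => ‖Z - Y‖ ^ 2) ((2 : ℝ) • (X - Y)) X := by
  rw [hasGradientAt_iff_hasFDerivAt]
  refine ((hasFDerivAt_id X).sub_const Y).norm_sq.congr_fderiv ?_
  ext Z
  simp [two_smul]

/-- The spectral sum of `s₁` cancels, leaving only differentiable terms. -/
theorem hasGradientAt_objective_sub_majorantReal (hs : IsDCDecomposition g s₁ s₂)
    (hf : Differentiable ℝ f) (Y X : Tensor n₁ n₂ n₃) :
    HasGradientAt (fun Z => (f Z + β * spectralSum U g Z) - majorantReal U f s₁ s₂ β ρ Y Z)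
      (gradient f X - gradient f Y - β • (gradient (spectralSum U s₂) X -
        gradient (spectralSum U s₂) Y) - ρ • (X - Y)) X := by
  set v := gradient f Y - β • gradient (spectralSum U s₂) Y with hv
  have h1 := (hf X).hasGradientAt.hasFDerivAt
  have h2 := (hasGradientAt_spectralSum U hs.convex_snd hs.symm_snd hs.differentiable_snd
    hs.locallyLipschitz_deriv_snd X).hasFDerivAt.const_mul β
  have h3 := (hasGradientAt_norm_sub_sq Y X).hasFDerivAt.const_mul (ρ / 2)
  have h4 := (innerSL ℝ v).hasFDerivAt (x := X)
  have h5 := (((h1.sub h2).sub h3).sub h4).add_const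
    (β * spectralSum U s₂ Y - f Y + inner ℝ v Y)
  rw [hasGradientAt_iff_hasFDerivAt]
  refine (h5.congr_fderiv ?_).congr_of_eventuallyEq (Eventually.of_forall fun Z => ?_)
  · ext Z
    simp only [sub_apply, smul_apply,
      InnerProductSpace.toDual_apply_apply, innerSL_apply_apply, hv, inner_sub_left,
      inner_smul_left, conj_trivial, smul_eq_mul]
    ring
  · simp only [Pi.sub_apply, majorantReal, hs.spectralSum_eq_sub, innerSL_apply_apply, hv,
      inner_sub_left, inner_smul_left, inner_sub_right, conj_trivial]
    ring

/-- The descent lemma handles `f`, and convexity lets the linearization of the `s₂` sum replace it.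
-/
theorem objective_le_majorantReal (hs : IsDCDecomposition g s₁ s₂) (hf : Differentiable ℝ f)
    {L : NNReal} (hL : LipschitzWith L (gradient f)) (hβ : 0 ≤ β) (Y X : Tensor n₁ n₂ n₃) :
    f X + β * spectralSum U g X ≤
      majorantReal U f s₁ s₂ β ρ Y X + (L - ρ) / 2 * ‖X - Y‖ ^ 2 := by
  have h1 := le_add_inner_add_sq_of_lipschitz_gradient (K := L) convex_univ
    (fun z _ => (hf z).hasGradientAt)
    (fun a _ b _ => by simpa [dist_eq_norm] using hL.dist_le_mul a b) (mem_univ Y) (mem_univ X)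
  have h2 := mul_le_mul_of_nonneg_left (spectralSum_add_inner_gradient_le U hs.convex_snd
    hs.symm_snd hs.differentiable_snd hs.locallyLipschitz_deriv_snd Y X) hβ
  rw [hs.spectralSum_eq_sub, majorantReal]
  linarith

theorem majorantReal_self (hs : IsDCDecomposition g s₁ s₂) (Y : Tensor n₁ n₂ n₃) :
    majorantReal U f s₁ s₂ β ρ Y Y = f Y + β * spectralSum U g Y := by
  rw [hs.spectralSum_eq_sub, majorantReal]
  simp
  ring

theorem continuous_objective (hg : IsRegularizer lam g) (hs : IsDCDecomposition g s₁ s₂)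
    (hf : Differentiable ℝ f) : Continuous fun X => f X + β * spectralSum U g X := by
  have h1 : Continuous (spectralSum U g : Tensor n₁ n₂ n₃ → ℝ) := by
    rw [funext (hs.spectralSum_eq_sub U)]
    exact (continuous_spectralSum U hs.convex_fst (hs.symm_fst hg)).sub
      (continuous_spectralSum U hs.convex_snd hs.symm_snd)
  exact hf.continuous.add (h1.const_mul β)

end Step

/-! ### Sequences of the algorithm -/

section Cluster

theorem nonneg_and_tendsto_of_antitone {h : ℕ → ℝ} (hh : Antitone h) (hc : MapClusterPt 0 atTop h) :
    (∀ t, 0 ≤ h t) ∧ Tendsto h atTop (𝓝 0) := by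
  rw [mapClusterPt_iff_frequently] at hc
  have h0 : ∀ t, 0 ≤ h t := by
    intro t
    by_contra! ht
    obtain ⟨k, hk, hk'⟩ := ((hc _ (lt_mem_nhds ht)).and_eventually (eventually_ge_atTop t)).exists
    exact absurd (hh hk') (not_le.2 hk)
  refine ⟨h0, tendsto_order.2 ⟨fun b hb => Eventually.of_forall fun t => hb.trans_le (h0 t),
    fun b hb => ?_⟩⟩
  obtain ⟨T, hT⟩ := (hc _ (gt_mem_nhds hb)).exists
  exact eventually_atTop.2 ⟨T, fun t ht => (hh ht).trans_lt hT⟩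

theorem le_of_one_le_mul_infEDist {E : Type*} [NormedAddCommGroup E] {S : Set E} {w : E}
    (hw : w ∈ S) {p b : ℝ} (hp : 0 ≤ p) (h : 1 ≤ ENNReal.ofReal p * Metric.infEDist 0 S)
    (hb : ‖w‖ ≤ b) : 1 ≤ p * b := by
  have h1 : Metric.infEDist 0 S ≤ ENNReal.ofReal b := by
    refine (Metric.infEDist_le_edist_of_mem hw).trans ?_
    rw [edist_dist, dist_zero_left]
    exact ENNReal.ofReal_le_ofReal hb
  have h2 := h.trans (mul_le_mul_right h1 _)
  rw [← ENNReal.ofReal_mul hp] at h2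
  exact ENNReal.one_le_ofReal.1 h2

end Cluster

section Main

variable {n₁ n₂ n₃ : ℕ} (U : Matrix.unitaryGroup (Fin n₃) ℂ) {f : Tensor n₁ n₂ n₃ → ℝ}
  {g s₁ s₂ : ℝ → ℝ} {lam β c ρ ξ : ℝ} {X : ℕ → Tensor n₁ n₂ n₃}

/-- After the first iteration, the sequences of the algorithm are descent sequences with the KL
property. -/
theorem exists_isKLDescent {L : NNReal} (hβ : 0 < β) (hg : IsRegularizer lam g)
    (hs : IsDCDecomposition g s₁ s₂) (hf : Differentiable ℝ f) (hL : LipschitzWith L (gradient f))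
    (hξ₀ : 0 < ξ) (hξ₁ : ξ < 1 / 2) (hρ : (L : ℝ) / (1 - 2 * ξ) < ρ)
    (hX : IsPMMSequence U f s₁ s₂ β c ρ ξ X) {x : Tensor n₁ n₂ n₃} (hlim : MapClusterPt x atTop X)
    {α : ℝ} (hα₀ : 0 ≤ α) (hα₁ : α < 1) (hKL : HasKLExponent (objective U f g β c) x α) :
    ∃ h a C r η, IsKLDescent (fun t => X (t + 1)) h x a C α r η := by
  have hL0 : (0 : ℝ) ≤ L := L.2
  have hρ0 : 0 < ρ := (div_nonneg hL0 (by linarith)).trans_lt hρ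
  have hρL : (L : ℝ) < ρ * (1 - 2 * ξ) := (div_lt_iff₀ (by linarith)).1 hρ
  set ψ : Tensor n₁ n₂ n₃ → ℝ := fun Z => f Z + β * spectralSum U g Z with hψ
  have hψc : Continuous ψ := continuous_objective U hg hs hf
  have hobj : ∀ Z ∈ box n₁ n₂ n₃ c, objective U f g β c Z = (ψ Z : EReal) :=
    fun Z hZ => coe_add_indicator_of_mem hZ
  choose W hW hWn using hX
  have hsub := fun t => subgradient_inequality
    (convexOn_majorantReal (c := c) (f := f) (s₂ := s₂) U hβ.le hρ0.le hs.convex_fst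
      (hs.symm_fst hg) (X t)) (hW t)
  have hbox : ∀ t, X (t + 1) ∈ box n₁ n₂ n₃ c := fun t => (hsub t).1
  -- The index shift is needed because `X 0` may lie outside the box.
  have hlim' : MapClusterPt x atTop fun t => X (t + 1) := by
    have : map (fun t => X (t + 1)) atTop = map X atTop := by
      conv_rhs => rw [← map_add_atTop_eq_nat 1, map_map]
      rfl
    rw [MapClusterPt, this]
    exact hlim
  have hx : x ∈ box n₁ n₂ n₃ c := by
    refine isClosed_box.closure_eq ▸ mem_closure_iff_nhds.2 fun V hV => ?_
    obtain ⟨t, ht⟩ := (mapClusterPt_iff_frequently.1 hlim' V hV).exists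
    exact ⟨_, ht, hbox t⟩
  -- The subgradient inequality at the new iterate is tested at the old one. The majorization gap
  -- gives `(ρ - L) / 2`, inexactness costs `ξ * ρ`, and the lower bound on `ρ` makes the
  -- coefficient positive.
  have hdec : ∀ t, ψ (X (t + 2)) + (ρ / 2 - L / 2 - ξ * ρ) * ‖X (t + 2) - X (t + 1)‖ ^ 2 ≤
      ψ (X (t + 1)) := by
    intro t
    have h1 := (hsub (t + 1)).2 _ (hbox t)
    rw [majorantReal_self U hs] at h1
    have h2 := objective_le_majorantReal (s₁ := s₁) (ρ := ρ) U hs hf hL hβ.le (X (t + 1)) (X (t + 2))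
    have h3 := neg_le_of_abs_le (abs_real_inner_le_norm (W (t + 1)) (X (t + 1) - X (t + 2)))
    have h4 := mul_le_mul_of_nonneg_right (hWn (t + 1)) (norm_nonneg (X (t + 1) - X (t + 2)))
    rw [norm_sub_rev (X (t + 1))] at h3 h4
    simp only [hψ]
    nlinarith
  obtain ⟨K, hK0, hK⟩ := exists_lipschitz_gradient_spectralSum (n₁ := n₁) (n₂ := n₂) U hs.convex_snd
    hs.symm_snd hs.differentiable_snd hs.locallyLipschitz_deriv_snd
    (√(Fintype.card (Fin n₁ × Fin n₂ × Fin n₃) * c ^ 2))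
  -- The terms account for inexactness, the gradient of `f`, the gradient of the `s₂` sum on the
  -- box, and the proximal term.
  set b := ξ * ρ + L + β * K + ρ with hb
  have hb0 : 0 < b := by positivity
  have herr : ∀ t, ∃ w ∈ subdifferential (objective U f g β c) (X (t + 2)),
      ‖w‖ ≤ b * ‖X (t + 2) - X (t + 1)‖ := by
    intro t
    refine ⟨_, add_gradient_mem_subdifferential (hbox (t + 1)) (hsub (t + 1)).2
      (hasGradientAt_objective_sub_majorantReal U hs hf (X (t + 1)) (X (t + 2))), ?_⟩
    have h1 : ‖gradient f (X (t + 2)) - gradient f (X (t + 1))‖ ≤ L * ‖X (t + 2) - X (t + 1)‖ := by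
      simpa [dist_eq_norm] using hL.dist_le_mul (X (t + 2)) (X (t + 1))
    have h2 := mul_le_mul_of_nonneg_left (hK _ _ (norm_le_of_mem_box (hbox (t + 1)))
      (norm_le_of_mem_box (hbox t))) hβ.le
    refine (norm_add_le _ _).trans ((add_le_add (hWn (t + 1)) ((norm_sub_le _ _).trans
      (add_le_add_left ((norm_sub_le _ _).trans (add_le_add_left h1 _)) _))).trans ?_)
    rw [norm_smul, norm_smul, Real.norm_of_nonneg hβ.le, Real.norm_of_nonneg hρ0.le]
    simp only [hb]
    linarith
  obtain ⟨μ, hμ, hKL⟩ := hKL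
  obtain ⟨η, hη, V, hV, hineq⟩ := hKL.ineq
  -- The KL threshold may be infinite; a smaller real one is enough.
  obtain ⟨η', hη'0, hη'⟩ := EReal.lt_iff_exists_real_btwn.1 hη.eta_pos
  obtain ⟨r, hr, hrV⟩ := Metric.mem_nhds_iff.1 hV
  set h : ℕ → ℝ := fun t => ψ (X (t + 1)) - ψ x with hh
  have hanti : Antitone h := antitone_nat_of_succ_le fun t => by
    have h1 : 0 ≤ (ρ / 2 - L / 2 - ξ * ρ) * ‖X (t + 2) - X (t + 1)‖ ^ 2 :=
      mul_nonneg (by linarith) (sq_nonneg _)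
    simp only [hh]
    linarith [hdec t]
  have hcl : MapClusterPt 0 atTop h := by
    have h1 := hlim'.continuousAt_comp ((hψc.sub continuous_const).continuousAt (x := x)
      (f := fun Z => ψ Z - ψ x))
    simpa [Function.comp_def] using h1
  obtain ⟨hnn, htend⟩ := nonneg_and_tendsto_of_antitone hanti hcl
  refine ⟨h, ρ / 2 - L / 2 - ξ * ρ, μ * (1 - α) * b, r, η', ⟨by linarith,
    mul_pos (mul_pos hμ (by linarith)) hb0, hr, by exact_mod_cast hη'0, hα₀, hα₁, hnn,
    fun t => ?_, htend, hlim', fun t htr ht0 htη => ?_⟩⟩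
  · simp only [hh]
    linarith [hdec t]
  · obtain ⟨w, hw, hwn⟩ := herr t
    have h1 := hineq (X (t + 2)) (hrV (by simpa [dist_eq_norm] using htr))
    rw [hobj _ (hbox (t + 1)), hobj _ hx, ← EReal.coe_sub, EReal.toReal_coe] at h1
    have h2 := h1 (by exact_mod_cast sub_pos.1 ht0) (by
      refine lt_of_lt_of_le ?_ (add_le_add_right hη'.le _)
      rw [← EReal.coe_add, EReal.coe_lt_coe_iff]
      simp only [hh] at htη
      linarith)
    have hder : deriv (fun s : ℝ => μ * s ^ (1 - α)) (h (t + 1)) =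
        μ * (1 - α) * h (t + 1) ^ (-α) := by
      rw [((Real.hasDerivAt_rpow_const (p := 1 - α) (Or.inl ht0.ne')).const_mul μ).deriv,
        sub_sub_cancel_left]
      ring
    change 1 ≤ ENNReal.ofReal (deriv (fun s : ℝ => μ * s ^ (1 - α)) (h (t + 1))) * _ at h2
    rw [hder] at h2
    have h3 := le_of_one_le_mul_infEDist hw (mul_nonneg (mul_nonneg hμ.le (by linarith))
      (Real.rpow_nonneg ht0.le _)) h2 hwn
    have h4 := mul_le_mul_of_nonneg_left h3 (Real.rpow_nonneg ht0.le α)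
    rw [Real.rpow_neg ht0.le, mul_one] at h4
    refine h4.trans (le_of_eq ?_)
    have : h (t + 1) ^ α ≠ 0 := (Real.rpow_pos_of_pos ht0 _).ne'
    field_simp

end Main

end PMM

end

theorem theorem3p2 {n₁ n₂ n₃ : ℕ} (U : Matrix.unitaryGroup (Fin n₃) ℂ)
    (f : PMM.Tensor n₁ n₂ n₃ → ℝ) (g s₁ s₂ : ℝ → ℝ) (lam β c ρ ξ : ℝ) (L : NNReal)
    (hlam : 0 < lam) (hβ : 0 < β) (hc : 0 < c)
    (hg : PMM.IsRegularizer lam g) (hs : PMM.IsDCDecomposition g s₁ s₂)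
    (hf : Differentiable ℝ f) (hL : LipschitzWith L (gradient f))
    (hfKL : PMM.IsKLFunction (fun X => (f X : EReal)))
    (hgKL : PMM.IsKLFunction (fun x => (g x : EReal)))
    (hξ₀ : 0 < ξ) (hξ₁ : ξ < 1 / 2) (hρ : (L : ℝ) / (1 - 2 * ξ) < ρ)
    (X : ℕ → PMM.Tensor n₁ n₂ n₃) (hX : PMM.IsPMMSequence U f s₁ s₂ β c ρ ξ X)
    (Xlim : PMM.Tensor n₁ n₂ n₃) (hlim : MapClusterPt Xlim atTop X)
    (α : ℝ) (hα₀ : 0 ≤ α) (hα₁ : α < 1)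
    (hKL : PMM.HasKLExponent (PMM.objective U f g β c) Xlim α) :
    Tendsto X atTop (𝓝 Xlim) ∧
    (α = 0 → ∃ T : ℕ, ∀ t ≥ T, X t = Xlim) ∧
    (0 < α → α ≤ 1 / 2 →
      ∃ w > (0 : ℝ), ∃ θ : ℝ, 0 ≤ θ ∧ θ < 1 ∧ ∀ t : ℕ, ‖X t - Xlim‖ ≤ w * θ ^ t) ∧
    (1 / 2 < α →
      ∃ w > (0 : ℝ), ∀ t : ℕ, 1 ≤ t →
        ‖X t - Xlim‖ ≤ w * (t : ℝ) ^ (-((1 - α) / (2 * α - 1)))) := by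
  obtain ⟨h, a, C, r, η, H⟩ :=
    PMM.exists_isKLDescent U hβ hg hs hf hL hξ₀ hξ₁ hρ hX hlim hα₀ hα₁ hKL
  refine ⟨(tendsto_add_atTop_iff_nat 1).1 H.tendsto_of_descent, fun h0 => ?_, fun _ h1 => ?_,
    fun h1 => ?_⟩
  · obtain ⟨T, hT⟩ := H.finite_termination h0
    refine ⟨T + 1, fun t ht => ?_⟩
    obtain ⟨n, rfl⟩ := Nat.exists_eq_add_of_le' ht
    exact hT (n + T) (by omega)
  · obtain ⟨w, -, θ, hθ0, hθ1, hw⟩ := H.linear_rate h1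
    obtain ⟨w', hw', hle⟩ := PMM.exists_forall_le_mul_of_eventually (t₀ := 0) (N := 1) (w := w / θ)
      (u := fun t => ‖X t - Xlim‖) (v := fun t => θ ^ t) (fun t _ => by positivity) fun t ht => by
        obtain ⟨n, rfl⟩ := Nat.exists_eq_add_of_le' ht
        refine (hw n).trans (le_of_eq ?_)
        rw [pow_succ]
        field_simp
    exact ⟨w', hw', θ, hθ0.le, hθ1, fun t => hle t (Nat.zero_le t)⟩
  · obtain ⟨w, hw0, hw⟩ := H.sublinear_rate h1
    set e := (1 - α) / (2 * α - 1) with he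
    have he0 : 0 ≤ e := div_nonneg (by linarith) (by linarith)
    -- Undoing the shift compares `n` with `n + 1`; for `n ≥ 1`, `(n + 1) / 2 ≤ n` costs the factor
    -- `2 ^ e`.
    refine PMM.exists_forall_le_mul_of_eventually (N := 2) (w := w * 2 ^ e)
      (u := fun t => ‖X t - Xlim‖) (v := fun t : ℕ => (t : ℝ) ^ (-e))
      (fun t ht => Real.rpow_pos_of_pos (by exact_mod_cast ht) _) fun t ht => ?_
    obtain ⟨n, rfl⟩ := Nat.exists_eq_add_of_le' (one_le_two.trans ht)
    have hn : 1 ≤ n := by omega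
    have hn' : (1 : ℝ) ≤ n := by exact_mod_cast hn
    refine (hw n hn).trans ?_
    rw [mul_assoc]
    refine mul_le_mul_of_nonneg_left ?_ hw0.le
    have h2 := Real.rpow_le_rpow_of_nonpos (x := ((n + 1 : ℕ) : ℝ) / 2) (y := n) (z := -e)
      (by positivity) (by push_cast; linarith) (by linarith)
    refine h2.trans (le_of_eq ?_)
    rw [Real.div_rpow (by positivity) (by positivity), Real.rpow_neg (by positivity : (0 : ℝ) ≤ 2),
      div_inv_eq_mul, mul_comm]
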